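/- In the LOCAL model, the nodes of the network are the vertices of a finite simple graph $G$ on $n$ vertices; each node has a unique identifier in $\{1,\dots,n\}$ and initially knows only $n$, its own identifier and its own local input. In each synchronous round every node sends a message to its neighbors, receives their messages and updates its state; the size of messages and the local computing power are unbounded, and all nodes run the same deterministic algorithm. The round complexity is the number of rounds until every node has irrevocably chosen its output. The arboricity of $G$ is the minimum number of edge-disjoint forests into which the edges of $G$ can be partitioned. A $k$-list-assignment of $G$ is a family of lists $(L(v))_{v\in V(G)}$ of colors with $|L(v)|\ge k$ for every vertex $v$. There is an absolute constant $C$ such that for every set of colors there is a deterministic algorithm in the LOCAL model with the following property. It holds for all integers $n$ and $a\ge 2$, every $n$-vertex graph $G$ of arboricity $a$, every assignment of unique identifiers in $\{1,\dots,n\}$ to the vertices of $G$, and every $2a$-list-assignment $L$ of $G$ with lists from the given set of colors, that if the local input of each vertex $v$ consists of $a$ and $L(v)$, then the algorithm finds an $L$-list-coloring of $G$ in at most $C\,a^4\log^3 n$ rounds, i.e. each vertex $v$ chooses a color $c(v)\in L(v)$ within that many rounds, and $c(v)\ne c(w)$ for every edge $vw$ of $G$. -/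

import Mathlib

universe u v

/-- A decomposition of the edges of `G` into `k` pairwise edge-disjoint forests. -/
structure IsForestPartition {V : Type v} (G : SimpleGraph V) (k : ℕ)
    (F : Fin k → SimpleGraph V) : Prop where
  acyclic : ∀ i, (F i).IsAcyclic
  disjoint : ∀ i j, i ≠ j → Disjoint (F i).edgeSet (F j).edgeSet
  cover : ⋃ i, (F i).edgeSet = G.edgeSet

/-- The arboricity: the minimum number of edge-disjoint forests into which the edges of `G` can
be partitioned. For a finite graph the set below is nonempty. -/
noncomputable def arboricity {V : Type v} (G : SimpleGraph V) : ℕ :=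
  sInf {k : ℕ | ∃ F : Fin k → SimpleGraph V, IsForestPartition G k F}

/-- A `k`-list-assignment: every vertex has a list of at least `k` colors. -/
def IsListAssignment {V : Type v} {Color : Type u} (k : ℕ) (L : V → Set Color) : Prop :=
  ∀ x, (k : ℕ∞) ≤ (L x).encard

/-- The unique identifiers of the nodes: distinct integers between `1` and the number of nodes. -/
structure IsIdentification {V : Type v} [Fintype V] (ident : V → ℕ) : Prop where
  injective : Function.Injective ident
  mem : ∀ x, ident x ∈ Finset.Icc 1 (Fintype.card V)

/-- A deterministic algorithm in the LOCAL model. All nodes run the same program. Message size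
and local computing power are unbounded, so states and messages are elements of arbitrary types
and the program consists of arbitrary functions. As a message may contain everything that its
sender knows, it is no restriction that in each round a node sends the same message to all its
neighbors. -/
structure LocalAlgorithm (Input Output : Type u) where
  /-- local states of a node -/
  State : Type u
  /-- messages -/
  Message : Type u
  /-- the initial state, from the number `n` of nodes, the node's own identifier and its own
  input -/
  init : (n : ℕ) → (ident : ℕ) → Input → State
  /-- the message sent to the neighbors in a round -/
  send : State → Message
  /-- the new state, from the old one and the messages received in the round, each of them
  labelled with the identifier of its sender -/
  step : State → Set (ℕ × Message) → State
  /-- the output chosen by the node, if it has chosen one -/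
  output : State → Option Output

namespace LocalAlgorithm

variable {Input Output : Type u} (A : LocalAlgorithm Input Output)
  {V : Type v} [Fintype V] (G : SimpleGraph V) (ident : V → ℕ) (input : V → Input)

/-- The state of each node after `t` synchronous rounds on the network `G`. -/
def state : ℕ → V → A.State
  | 0, x => A.init (Fintype.card V) (ident x) (input x)
  | t + 1, x => A.step (state t x)
      {m | ∃ y, G.Adj x y ∧ m = (ident y, A.send (state t y))}

/-- Node `x` chooses its output after exactly `t` rounds, and its choice is `o`. -/
def Chooses (x : V) (t : ℕ) (o : Output) : Prop :=
  A.output (A.state G ident input t x) = some o ∧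
    ∀ s < t, A.output (A.state G ident input s x) = none

end LocalAlgorithm

/-!
Write `d = 2 * a`. A graph of arboricity `a` satisfies `DegreeSparse d`: every nonempty set `W` of
vertices induces at most `a * (|W| - 1)` edges. The algorithm repeatedly removes *clusters* from the
graph: connected sets of radius `r = O(d log n)` whose vertices have degree at most `d` in the
remaining graph and which can be colored after all other vertices (`IsCluster`). The removed
vertices are then colored in the reverse order of their removal.

*Few removal steps suffice.* By `card_le_card_clustered`, the clusters cover a fraction
`1 / (14 * d ^ 2)` of the remaining vertices, so `O(d ^ 2 log n)` steps remove everything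
(`peelLevel_lt`). The vertices of degree less than `d` are clusters by themselves, and the remaining
ones of degree at most `d` have degree exactly `d`. The graph that these induce is cut into balls of
logarithmic radius, each left by few edges (`exists_ball_few_leaving`). None of the balls is
degree-choosable, and such a set `U` spans at most `(d - 1 / 4) * |U| / 2` edges
(`sum_degIn_le_of_not_degreeChoosable`). The latter replaces the structure theory of Gallai
trees: in a connected set that is not degree-choosable, the degree does not decrease from a
vertex that is not a cut vertex to its neighbors (`ConnectedOn.degIn_le_degIn`), so the part behind
an extremal cut vertex has constant degree, and by sparsity this degree is less than `d`
(`exists_sparse_piece`). Hence many edges lead from these vertices to clustered vertices and to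
vertices of degree more than `d`, and sparsity bounds the number of the latter by the number of the
former.

*Coloring one level.* In the graph of the edges inside the levels, whose maximum degree is at most
`d`, one computes a ruling set of roots (`bitRulingSet`) and a proper coloring with `d + 1` colors
(`bitColoring`), both by recursion on the bits of the identifiers. The clusters of the roots are
pairwise disjoint and nonadjacent. The other vertices of the level are colored greedily, in the
order of decreasing distance from these clusters with ties broken by the `d + 1` colors. Each of
them has an uncolored neighbor at its turn, so `d` colors suffice. The clusters come last, which
is possible by the definition of a cluster (`Schedule.IsValid.colorLevel_spec`). A level costs
`O(d ^ 2 log ^ 2 n)` rounds, the product of the maximal distance and `d + 1`.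

*Locality.* Since messages are unbounded, it is enough that the output of a node is a function of
its neighborhood up to the distance that equals the number of rounds (`gatherAlgorithm_chooses`).
This is expressed by `Agreement`, through comparison of two networks that look the same near a node,
and it is checked for each ingredient in turn.
-/

noncomputable section
open scoped Classical

/-! ### Choosability and degrees inside a set -/

section Choosability
variable {V : Type*} {Color : Type*}

/-- The number of neighbors of `x` in `W`. -/
def degIn (G : SimpleGraph V) (W : Finset V) (x : V) : ℕ := (W.filter (G.Adj x)).card

/-- The subgraph induced by `U` has a proper coloring from the lists `L`. -/
def ListColorable (G : SimpleGraph V) (U : Finset V) (L : V → Finset Color) : Prop :=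
  ∃ c : V → Color, (∀ x ∈ U, c x ∈ L x) ∧ ∀ x ∈ U, ∀ y ∈ U, G.Adj x y → c x ≠ c y

/-- `U` induces a connected (possibly empty) subgraph, in the form that every proper nonempty
part of `U` is left by an edge of the induced subgraph. -/
def ConnectedOn (G : SimpleGraph V) (U : Finset V) : Prop :=
  ∀ X ⊆ U, X.Nonempty → X ≠ U → ∃ x ∈ X, ∃ y ∈ U \ X, G.Adj x y

/-- The subgraph induced by `U` is colorable from all lists that are at least as long as its
degrees. -/
def DegreeChoosable (Color : Type*) (G : SimpleGraph V) (U : Finset V) : Prop :=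
  ∀ L : V → Finset Color, (∀ x ∈ U, degIn G U x ≤ (L x).card) → ListColorable G U L

variable {G : SimpleGraph V}

lemma degIn_mono {W W' : Finset V} (h : W ⊆ W') (x : V) : degIn G W x ≤ degIn G W' x :=
  Finset.card_le_card (Finset.filter_subset_filter _ h)

lemma degIn_union {W W' : Finset V} (h : Disjoint W W') (x : V) :
    degIn G (W ∪ W') x = degIn G W x + degIn G W' x := by
  unfold degIn
  rw [Finset.filter_union, Finset.card_union_of_disjoint]
  exact Finset.disjoint_filter_filter h

lemma degIn_add_sdiff {W X : Finset V} (h : X ⊆ W) (x : V) :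
    degIn G W x = degIn G X x + degIn G (W \ X) x := by
  rw [← degIn_union Finset.disjoint_sdiff, Finset.union_sdiff_of_subset h]

lemma degIn_le_card (W : Finset V) (x : V) : degIn G W x ≤ W.card :=
  Finset.card_filter_le _ _

lemma sum_degIn_comm (X Y : Finset V) :
    ∑ x ∈ X, degIn G Y x = ∑ y ∈ Y, degIn G X y := by
  unfold degIn
  simp only [Finset.card_filter]
  rw [Finset.sum_comm]
  simp only [G.adj_comm]

/-- Twice the number of edges of `W` is twice the number of edges of `W \ X` plus twice the number
of edges touching `X`. -/
lemma sum_degIn_sdiff {W X : Finset V} (h : X ⊆ W) :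
    ∑ x ∈ W, degIn G W x = ∑ x ∈ W \ X, degIn G (W \ X) x +
      (∑ x ∈ X, degIn G W x + ∑ x ∈ X, degIn G (W \ X) x) := by
  rw [← Finset.sum_sdiff h, sum_degIn_comm X (W \ X)]
  simp only [degIn_add_sdiff (G := G) h, Finset.sum_add_distrib]
  ring

/-- If every nonempty part of `W` can be shrunk by a set touched by few edges, then `W` has few
edges. -/
lemma sum_degIn_le_of_pieces {p q : ℕ} (W : Finset V)
    (h : ∀ W' ⊆ W, W'.Nonempty → ∃ X ⊆ W', X.Nonempty ∧
      q * (∑ x ∈ X, degIn G W' x + ∑ x ∈ X, degIn G (W' \ X) x) ≤ p * X.card) :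
    q * ∑ x ∈ W, degIn G W x ≤ p * W.card := by
  induction W using Finset.strongInduction with
  | H W ih =>
    rcases W.eq_empty_or_nonempty with rfl | hW
    · simp
    obtain ⟨X, hXW, hX, hle⟩ := h W subset_rfl hW
    have hss : W \ X ⊂ W := Finset.sdiff_ssubset hXW hX
    have := ih _ hss fun W' hW' => h W' (hW'.trans hss.subset)
    rw [sum_degIn_sdiff hXW, ← Finset.card_sdiff_add_card_eq_card hXW]
    simp only [mul_add] at *
    omega

/-- A coloring `c` of `A` extends to `B` if `B` is colorable from the colors that `c` leaves. -/
lemma ListColorable.union {A B : Finset V} {L : V → Finset Color} {c : V → Color}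
    (hc : ∀ x ∈ A, c x ∈ L x) (hc' : ∀ x ∈ A, ∀ y ∈ A, G.Adj x y → c x ≠ c y)
    (hB : ListColorable G B fun x => L x \ (A.filter (G.Adj x)).image c) :
    ListColorable G (A ∪ B) L := by
  obtain ⟨c', h1, h2⟩ := hB
  refine ⟨fun x => if x ∈ B then c' x else c x, fun x hx => ?_, fun x hx y hy hxy => ?_⟩
  · by_cases hxB : x ∈ B
    · simp only [hxB, if_true]
      exact (Finset.mem_sdiff.1 (h1 x hxB)).1
    · simp only [hxB, if_false]
      exact hc x (by simpa [hxB] using hx)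
  · have key : ∀ u ∈ B, ∀ w ∈ A, G.Adj u w → c' u ≠ c w := by
      intro u hu w hw huw he
      refine (Finset.mem_sdiff.1 (h1 u hu)).2 ?_
      rw [he]
      exact Finset.mem_image_of_mem _ (Finset.mem_filter.2 ⟨hw, huw⟩)
    by_cases hxB : x ∈ B <;> by_cases hyB : y ∈ B <;> simp only [hxB, hyB, if_true, if_false]
    · exact h2 x hxB y hyB hxy
    · exact key x hxB y (by simpa [hyB] using hy) hxy
    · exact (key y hyB x (by simpa [hxB] using hx) hxy.symm).symm
    · exact hc' x (by simpa [hxB] using hx) y (by simpa [hyB] using hy) hxy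

lemma card_le_card_sdiff_image (A : Finset V) (s : Finset Color) (c : V → Color) (x : V) :
    s.card ≤ (s \ (A.filter (G.Adj x)).image c).card + degIn G A x := by
  have h1 := Finset.le_card_sdiff ((A.filter (G.Adj x)).image c) s
  have h2 : ((A.filter (G.Adj x)).image c).card ≤ degIn G A x := Finset.card_image_le
  omega

lemma listColorable_singleton {L : V → Finset Color} {x : V} (h : 0 < (L x).card) :
    ListColorable G {x} L := by
  obtain ⟨col, hcol⟩ := Finset.card_pos.1 h
  refine ⟨fun _ => col, fun y hy => ?_, fun y hy z hz hyz => ?_⟩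
  · rwa [Finset.mem_singleton.1 hy]
  · rw [Finset.mem_singleton.1 hy, Finset.mem_singleton.1 hz] at hyz
    exact absurd hyz (G.loopless.irrefl x)

/-- Coloring a connected set towards `T`: a vertex outside `T` is colored while one of its
neighbors is still uncolored, so lists as long as the degrees suffice. -/
lemma ConnectedOn.listColorable_sdiff [Nonempty Color] {U T : Finset V} (hU : ConnectedOn G U)
    (hTU : T ⊆ U) (hT : T.Nonempty) {L : V → Finset Color}
    (hL : ∀ x ∈ U \ T, degIn G U x ≤ (L x).card) : ListColorable G (U \ T) L := by
  induction hn : (U \ T).card generalizing T with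
  | zero =>
    rw [Finset.card_eq_zero] at hn
    rw [hn]
    exact ⟨fun _ => Classical.arbitrary _, by simp, by simp⟩
  | succ k ih =>
    have hne : T ≠ U := by
      rintro rfl
      simp at hn
    obtain ⟨x, hx, y, hy, hxy⟩ := hU T hTU hT hne
    have hyU := (Finset.mem_sdiff.1 hy).1
    have hyT := (Finset.mem_sdiff.1 hy).2
    have hsub : insert y T ⊆ U := Finset.insert_subset hyU hTU
    have hins : U \ insert y T = (U \ T).erase y := by
      ext w; simp only [Finset.mem_sdiff, Finset.mem_insert, Finset.mem_erase]; tauto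
    obtain ⟨c, hc, hc'⟩ := ih hsub (Finset.insert_nonempty _ _)
      (fun w hw => hL w (by rw [hins] at hw; exact Finset.mem_of_mem_erase hw))
      (by rw [hins, Finset.card_erase_of_mem hy, hn]; rfl)
    have hun : U \ T = (U \ insert y T) ∪ {y} := by
      rw [hins, Finset.union_comm, ← Finset.insert_eq, Finset.insert_erase hy]
    rw [hun]
    refine ListColorable.union hc hc' (listColorable_singleton ?_)
    have h1 := card_le_card_sdiff_image (G := G) (U \ insert y T) (L y) c y
    have h2 := hL y hy
    have h3 : degIn G (U \ insert y T) y < degIn G U y := by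
      refine Finset.card_lt_card ⟨Finset.filter_subset_filter _ Finset.sdiff_subset, fun h => ?_⟩
      have := h (Finset.mem_filter.2 ⟨hTU hx, hxy.symm⟩)
      simp [hx] at this
    omega

/-- A connected set with lists as long as the degrees is colorable if its part `T` is colorable from
what coloring the rest leaves of the lists. -/
lemma ConnectedOn.listColorable_of_extend [Nonempty Color] {U T : Finset V} (hU : ConnectedOn G U)
    (hTU : T ⊆ U) (hT : T.Nonempty) {L : V → Finset Color}
    (hL : ∀ x ∈ U, degIn G U x ≤ (L x).card)
    (h : ∀ L' : V → Finset Color, (∀ x ∈ T, degIn G T x + (L x).card ≤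
      (L' x).card + degIn G U x) → ListColorable G T L') : ListColorable G U L := by
  obtain ⟨c, hc, hc'⟩ := hU.listColorable_sdiff hTU hT fun x hx => hL x (Finset.sdiff_subset hx)
  rw [← Finset.sdiff_union_of_subset hTU]
  refine ListColorable.union hc hc' (h _ fun x hx => ?_)
  have h1 := card_le_card_sdiff_image (G := G) (U \ T) (L x) c x
  have h2 := degIn_add_sdiff (G := G) hTU x
  omega

/-- A connected set is colorable from lists as long as the degrees if one of them is longer: the
vertex with the longer list is colored last. -/
lemma ConnectedOn.listColorable_of_surplus [Nonempty Color] {U : Finset V} (hU : ConnectedOn G U)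
    {L : V → Finset Color} (hL : ∀ x ∈ U, degIn G U x ≤ (L x).card) {x : V} (hx : x ∈ U)
    (hlt : degIn G U x < (L x).card) : ListColorable G U L := by
  refine hU.listColorable_of_extend (T := {x}) (by simpa using hx) (by simp) hL fun L' hL' => ?_
  have := hL' x (by simp)
  exact listColorable_singleton (by omega)

/-- A connected set with a degree-choosable part is degree-choosable. -/
lemma DegreeChoosable.of_subset [Nonempty Color] {U T : Finset V} (hU : ConnectedOn G U)
    (hTU : T ⊆ U) (hT : T.Nonempty) (h : DegreeChoosable Color G T) :
    DegreeChoosable Color G U := by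
  intro L hL
  refine hU.listColorable_of_extend hTU hT hL fun L' hL' => h L' fun x hx => ?_
  have := hL' x hx
  have := hL x (hTU hx)
  omega

/-- In a connected set that is not degree-choosable, the degree does not decrease from a vertex that
is not a cut vertex to its neighbors: for lists that admit no coloring, the degrees are the sizes
of the lists, and the list of such a vertex is contained in those of its neighbors. -/
lemma ConnectedOn.degIn_le_degIn [Nonempty Color] {U : Finset V} (hU : ConnectedOn G U)
    (hbad : ¬ DegreeChoosable Color G U) {y y' : V} (hy : y ∈ U) (hy' : y' ∈ U)
    (hadj : G.Adj y y') (hcut : ConnectedOn G (U.erase y)) : degIn G U y ≤ degIn G U y' := by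
  unfold DegreeChoosable at hbad
  push Not at hbad
  obtain ⟨L, hL, hno⟩ := hbad
  have heq : ∀ x ∈ U, degIn G U x = (L x).card := fun x hx =>
    le_antisymm (hL x hx) (not_lt.1 fun h => hno (hU.listColorable_of_surplus hL hx h))
  rw [heq y hy, heq y' hy']
  refine Finset.card_le_card fun col hcol => ?_
  -- otherwise coloring `y` with `col` costs `y'` a neighbor but no color
  by_contra hcol'
  apply hno
  have hsub : {y} ⊆ U := by simpa using hy
  have hU' : U = {y} ∪ U.erase y := by rw [← Finset.insert_eq, Finset.insert_erase hy]
  have hdeg (x : V) : degIn G U x = degIn G {y} x + degIn G (U.erase y) x := by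
    rw [degIn_add_sdiff (G := G) hsub, Finset.sdiff_singleton_eq_erase]
  rw [hU']
  refine ListColorable.union (c := fun _ => col) (by simpa using hcol) ?_ ?_
  · intro u hu w hw huw
    rw [Finset.mem_singleton.1 hu, Finset.mem_singleton.1 hw] at huw
    exact absurd huw (G.loopless.irrefl y)
  · have hy'e : y' ∈ U.erase y := Finset.mem_erase.2 ⟨hadj.ne', hy'⟩
    refine hcut.listColorable_of_surplus (fun x hx => ?_) hy'e ?_
    · have h1 := card_le_card_sdiff_image (G := G) {y} (L x) (fun _ => col) x
      have h2 := heq x (Finset.mem_of_mem_erase hx)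
      have h3 := hdeg x
      omega
    · have h1 : 0 < degIn G {y} y' :=
        Finset.card_pos.2 ⟨y, Finset.mem_filter.2 ⟨by simp, hadj.symm⟩⟩
      have h2 := heq y' hy'
      have h3 := hdeg y'
      rw [Finset.sdiff_eq_self_of_disjoint]
      · omega
      · rw [Finset.disjoint_right]
        intro col1 h
        obtain ⟨_, _, rfl⟩ := Finset.mem_image.1 h
        exact hcol'

end Choosability

/-! ### The density of sets that are not degree-choosable -/

section Density
variable {V : Type*} {Color : Type*} {G : SimpleGraph V}

lemma exists_component {W : Finset V} (hW : W.Nonempty) :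
    ∃ B ⊆ W, B.Nonempty ∧ ConnectedOn G B ∧ ∀ x ∈ B, ∀ y ∈ W \ B, ¬ G.Adj x y := by
  obtain ⟨B, hB, hmin⟩ := Finset.exists_min_image
    (W.powerset.filter fun B => B.Nonempty ∧ ∀ x ∈ B, ∀ y ∈ W \ B, ¬ G.Adj x y)
    Finset.card ⟨W, by simp +contextual [hW]⟩
  simp only [Finset.mem_filter, Finset.mem_powerset] at hB hmin
  refine ⟨B, hB.1, hB.2.1, fun X hXB hX hne => ?_, hB.2.2⟩
  by_contra! hcon
  have hlt := Finset.card_lt_card (hXB.ssubset_of_ne hne)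
  refine absurd (hmin X ⟨hXB.trans hB.1, hX, fun x hx y hy => ?_⟩) (by omega)
  by_cases hyB : y ∈ B
  · exact hcon x hx y (Finset.mem_sdiff.2 ⟨hyB, (Finset.mem_sdiff.1 hy).2⟩)
  · exact hB.2.2 x (hXB hx) y (Finset.mem_sdiff.2 ⟨(Finset.mem_sdiff.1 hy).1, hyB⟩)

lemma degIn_eq_of_no_adj {W B : Finset V} (hBW : B ⊆ W) {x : V}
    (h : ∀ y ∈ W \ B, ¬ G.Adj x y) : degIn G W x = degIn G B x := by
  rw [degIn_add_sdiff hBW]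
  simp only [Nat.add_eq_left]
  exact Finset.card_eq_zero.2 (Finset.filter_eq_empty_iff.2 fun {y} hy => h y hy)

/-- A function that does not decrease along any edge of the connected set `K`, in either direction,
is constant on `K`. -/
lemma ConnectedOn.eq_of_le {K : Finset V} (hK : ConnectedOn G K) {f : V → ℕ}
    (h : ∀ x ∈ K, ∀ y ∈ K, G.Adj x y → f x ≤ f y) {x y : V} (hx : x ∈ K) (hy : y ∈ K) :
    f x = f y := by
  by_contra hne
  obtain ⟨u, hu, w, hw, huw⟩ := hK (K.filter fun w => f w = f x) (Finset.filter_subset _ _)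
    ⟨x, by simp [hx]⟩ (fun h => hne (by
      have := h ▸ hy
      exact (Finset.mem_filter.1 this).2.symm))
  simp only [Finset.mem_filter, Finset.mem_sdiff, not_and] at hu hw
  exact hw.2 hw.1 ((le_antisymm (h u hu.1 w hw.1 huw) (h w hw.1 u hu.1 huw.symm)).symm.trans hu.2)

/-- If the connected set `B` has a cut vertex, then some `z ∈ B` cuts off a connected part `K` of
`B` without cut vertices of `B`. -/
lemma ConnectedOn.exists_end_part {B : Finset V} (hB : ConnectedOn G B)
    (hcut : ∃ z ∈ B, ¬ ConnectedOn G (B.erase z)) :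
    ∃ z ∈ B, ∃ K ⊆ B.erase z, K.Nonempty ∧ ConnectedOn G K ∧
      (∀ x ∈ K, ∀ y ∈ B.erase z \ K, ¬ G.Adj x y) ∧ ∀ y ∈ K, ConnectedOn G (B.erase y) := by
  let P : V × Finset V → Prop := fun p => p.2 ⊆ B.erase p.1 ∧ p.2.Nonempty ∧ p.2 ≠ B.erase p.1 ∧
    ∀ x ∈ p.2, ∀ y ∈ B.erase p.1 \ p.2, ¬ G.Adj x y
  obtain ⟨z0, hz0, hcut⟩ := hcut
  unfold ConnectedOn at hcut
  push Not at hcut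
  obtain ⟨X0, h1, h2, h3, h4⟩ := hcut
  obtain ⟨⟨z, K⟩, hp, hmin⟩ := Finset.exists_min_image
    ((B ×ˢ B.powerset).filter P) (fun p => p.2.card)
    ⟨(z0, X0), by
      simp only [Finset.mem_filter, Finset.mem_product, Finset.mem_powerset]
      exact ⟨⟨hz0, h1.trans (Finset.erase_subset _ _)⟩, h1, h2, h3, h4⟩⟩
  simp only [Finset.mem_filter, Finset.mem_product, Finset.mem_powerset] at hp
  obtain ⟨⟨hzB, hKB⟩, hKz, hK, hKne, hKcl⟩ := hp
  have hmin' : ∀ z' ∈ B, ∀ K' : Finset V, P (z', K') → K.card ≤ K'.card := fun z' hz' K' h =>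
    hmin (z', K') (by
      simp only [Finset.mem_filter, Finset.mem_product, Finset.mem_powerset]
      exact ⟨⟨hz', h.1.trans (Finset.erase_subset _ _)⟩, h⟩)
  have hzK : z ∉ K := fun h => Finset.notMem_erase z B (hKz h)
  refine ⟨z, hzB, K, hKz, hK, fun X hXK hX hne => ?_, hKcl, fun y hy => ?_⟩
  · by_contra! hcon
    have hlt := Finset.card_lt_card (hXK.ssubset_of_ne hne)
    refine absurd (hmin' z hzB X ⟨hXK.trans hKz, hX, ?_, fun x hx y hy => ?_⟩) (by omega)
    · intro h
      exact hne (hXK.antisymm (hKz.trans (le_of_eq h.symm)))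
    · by_cases hyK : y ∈ K
      · exact hcon x hx y (Finset.mem_sdiff.2 ⟨hyK, (Finset.mem_sdiff.1 hy).2⟩)
      · exact hKcl x (hXK hx) y (Finset.mem_sdiff.2 ⟨(Finset.mem_sdiff.1 hy).1, hyK⟩)
  · -- a side of `B.erase y` that avoids `z` lies in `K`, so it would be a smaller choice of `K`
    have key : ∀ X ⊆ B.erase y, X.Nonempty → z ∉ X →
        (∀ x ∈ X, ∀ w ∈ B.erase y \ X, ¬ G.Adj x w) → False := by
      intro X hX hXne hzX hXcl
      have hyX : y ∉ X := fun h => Finset.notMem_erase y B (hX h)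
      have hyB : y ∈ B := hKB hy
      have hyz : y ≠ z := fun h => hzK (h ▸ hy)
      by_cases hXK : (X ∩ K).Nonempty
      · have hlt : (X ∩ K).card < K.card := Finset.card_lt_card
          ⟨Finset.inter_subset_right, fun h => hyX (Finset.mem_inter.1 (h hy)).1⟩
        refine absurd (hmin' y hyB (X ∩ K) ⟨Finset.inter_subset_left.trans hX, hXK, ?_, ?_⟩)
          (by omega)
        · intro h
          have : z ∈ X ∩ K := by
            have hz : z ∈ B.erase y := Finset.mem_erase.2 ⟨hyz.symm, hzB⟩
            rwa [← h] at hz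
          exact hzK (Finset.mem_inter.1 this).2
        · intro x hx w hw hxw
          simp only [Finset.mem_inter, Finset.mem_sdiff, Finset.mem_erase] at hx hw hX hXcl hKcl
          by_cases hwX : w ∈ X
          · exact hKcl x hx.2 w ⟨⟨fun h => hzX (h ▸ hwX), hw.1.2⟩, fun h => hw.2 ⟨hwX, h⟩⟩ hxw
          · exact hXcl x hx.1 w ⟨hw.1, hwX⟩ hxw
      · rw [Finset.not_nonempty_iff_eq_empty] at hXK
        have hXK' : ∀ x ∈ X, x ∉ K := fun x hx hxK => by
          have := Finset.mem_inter.2 ⟨hx, hxK⟩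
          simp [hXK] at this
        obtain ⟨x, hx, w, hw, hxw⟩ := hB X (hX.trans (Finset.erase_subset _ _)) hXne
          (fun h => hzX (h ▸ hzB))
        simp only [Finset.mem_sdiff, Finset.mem_erase] at hw hXcl hKcl
        by_cases hwy : w = y
        · subst hwy
          refine hKcl w hy x ⟨⟨fun h => hzX (h ▸ hx), ?_⟩, hXK' x hx⟩ hxw.symm
          exact Finset.mem_of_mem_erase (hX hx)
        · exact hXcl x hx w ⟨⟨hwy, hw.1⟩, hw.2⟩ hxw
    intro X hX hXne hne
    by_contra! hcon
    by_cases hzX : z ∈ X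
    · refine key (B.erase y \ X) Finset.sdiff_subset ?_ (by simp [hzX]) ?_
      · exact Finset.sdiff_nonempty.2 fun h => hne (hX.antisymm h)
      · intro x hx w hw hxw
        refine hcon w ?_ x hx hxw.symm
        simp only [Finset.mem_sdiff] at hw
        by_contra hwX
        exact hw.2 ⟨hw.1, hwX⟩
    · exact key X hX hXne hzX hcon

/-- Sparsity in terms of degree sums: every nonempty set of vertices induces fewer edges than
`d / 2` times its size, by at least `d / 2`. -/
def DegreeSparse (d : ℕ) (G : SimpleGraph V) : Prop :=
  ∀ W : Finset V, W.Nonempty → ∑ x ∈ W, degIn G W x + d ≤ d * W.card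

/-- If no connected part of `W` is degree-choosable, then some part `X` is touched by few edges of
`W`, counted twice on the left-hand side. It is a component without cut vertices, or the part `K`
behind a cut vertex `z` with or without `z`. -/
lemma exists_sparse_piece [Nonempty Color] {d : ℕ} (hd : 4 ≤ d) (hsp : DegreeSparse d G)
    {W : Finset V} (hW : W.Nonempty) (hdeg : ∀ x ∈ W, degIn G W x ≤ d)
    (hbad : ∀ B ⊆ W, B.Nonempty → ConnectedOn G B → ¬ DegreeChoosable Color G B) :
    ∃ X ⊆ W, X.Nonempty ∧
      4 * (∑ x ∈ X, degIn G W x + ∑ x ∈ X, degIn G (W \ X) x) ≤ (4 * d - 1) * X.card := by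
  obtain ⟨B, hBW, hBne, hB, hBcl⟩ := exists_component (G := G) hW
  have hdB : ∀ x ∈ B, degIn G W x = degIn G B x := fun x hx =>
    degIn_eq_of_no_adj hBW (hBcl x hx)
  have hBbad := hbad B hBW hBne hB
  by_cases hcut : ∃ z ∈ B, ¬ ConnectedOn G (B.erase z)
  · obtain ⟨z, hz, K, hKz, hK, hKconn, hKcl, hKcut⟩ := hB.exists_end_part hcut
    have hKB : K ⊆ B := hKz.trans (Finset.erase_subset _ _)
    have hzK : z ∉ K := fun h => Finset.notMem_erase z B (hKz h)
    obtain ⟨y0, hy0⟩ := hK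
    set k := degIn G B y0 with hk
    have hconst : ∀ y ∈ K, degIn G B y = k := fun y hy =>
      hKconn.eq_of_le (fun x hx y hy hxy =>
        hB.degIn_le_degIn hBbad (hKB hx) (hKB hy) hxy (hKcut x hx)) hy hy0
    have hkd : k ≤ d := by rw [hk, ← hdB y0 (hKB hy0)]; exact hdeg y0 (hBW (hKB hy0))
    set m := degIn G K z with hm
    -- the neighbors of `K` outside `K` are all equal to `z`
    have hout : ∀ x ∈ K, ∀ y ∈ W \ K, G.Adj x y → y = z := by
      intro x hx y hy hxy
      by_contra hyz
      have hyW := (Finset.mem_sdiff.1 hy).1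
      by_cases hyB : y ∈ B
      · exact hKcl x hx y (Finset.mem_sdiff.2
          ⟨Finset.mem_erase.2 ⟨hyz, hyB⟩, (Finset.mem_sdiff.1 hy).2⟩) hxy
      · exact hBcl x (hKB hx) y (Finset.mem_sdiff.2 ⟨hyW, hyB⟩) hxy
    have hsum1 : ∑ x ∈ K, degIn G W x = k * K.card := by
      rw [Finset.sum_congr rfl fun x hx => (hdB x (hKB hx)).trans (hconst x hx),
        Finset.sum_const, smul_eq_mul, mul_comm]
    have hzout : {z} ⊆ W \ K := by
      simpa [hzK] using hBW hz
    have hsum2 : ∑ x ∈ K, degIn G (W \ K) x = m := by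
      have : ∀ x ∈ K, degIn G (W \ K) x = degIn G {z} x := fun x hx =>
        degIn_eq_of_no_adj hzout fun y hy hxy => by
          simp only [Finset.mem_sdiff, Finset.mem_singleton] at hy
          exact hy.2 (hout x hx y (Finset.mem_sdiff.2 hy.1) hxy)
      rw [Finset.sum_congr rfl this, sum_degIn_comm, Finset.sum_singleton]
    have hmK : m ≤ K.card := degIn_le_card _ _
    have hm1 : 1 ≤ m := by
      obtain ⟨x, hx, y, hy, hxy⟩ := hB K hKB ⟨y0, hy0⟩ (fun h => hzK (h ▸ hz))
      have : y = z := hout x hx y (Finset.sdiff_subset_sdiff hBW subset_rfl hy) hxy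
      subst this
      exact Finset.card_pos.2 ⟨x, Finset.mem_filter.2 ⟨hx, hxy.symm⟩⟩
    have hKz' : degIn G K y0 + 1 ≤ K.card := by
      refine Finset.card_lt_card ⟨Finset.filter_subset _ _, fun h => ?_⟩
      exact G.loopless.irrefl y0 (Finset.mem_filter.1 (h hy0)).2
    have hKk : k ≤ K.card := by
      have h1 : degIn G W y0 = degIn G (insert z K) y0 := by
        refine degIn_eq_of_no_adj (Finset.insert_subset (hBW hz) (hKB.trans hBW)) fun y hy h => ?_
        simp only [Finset.mem_sdiff, Finset.mem_insert, not_or] at hy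
        exact hy.2.1 (hout y0 hy0 y (Finset.mem_sdiff.2 ⟨hy.1, hy.2.2⟩) h)
      have h2 : degIn G (insert z K) y0 = degIn G {z} y0 + degIn G K y0 := by
        rw [Finset.insert_eq, degIn_union (by simpa using hzK)]
      have h3 : degIn G {z} y0 ≤ 1 := (degIn_le_card _ _).trans (by simp)
      have h4 := hdB y0 (hKB hy0)
      omega
    have hdz := hdeg z (hBW hz)
    have hzW : degIn G W z = m + degIn G (W \ K) z := degIn_add_sdiff (hKB.trans hBW) z
    have hKpos : 1 ≤ K.card := Finset.card_pos.2 ⟨y0, hy0⟩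
    rcases Nat.lt_or_ge (k + 1) d with hlt | hge
    · refine ⟨K, hKB.trans hBW, ⟨y0, hy0⟩, ?_⟩
      rw [hsum1, hsum2]
      obtain ⟨e, rfl⟩ : ∃ e, d = k + 2 + e := ⟨d - (k + 2), by omega⟩
      have : 4 * (k + 2 + e) - 1 = 4 * k + 7 + 4 * e := by omega
      rw [this]
      nlinarith
    have hsumD1 : ∑ x ∈ insert z K, degIn G W x = degIn G W z + k * K.card := by
      rw [Finset.sum_insert hzK, hsum1]
    have hDW : insert z K ⊆ W := Finset.insert_subset (hBW hz) (hKB.trans hBW)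
    have hcardD : (insert z K).card = K.card + 1 := Finset.card_insert_of_notMem hzK
    have hsumD2 : ∑ x ∈ insert z K, degIn G (W \ insert z K) x = degIn G (W \ K) z := by
      rw [Finset.sum_insert hzK, Finset.sum_eq_zero, add_zero]
      · refine (degIn_eq_of_no_adj (Finset.sdiff_subset_sdiff subset_rfl
          (Finset.subset_insert _ _)) fun y hy h => ?_).symm
        simp only [Finset.mem_sdiff, Finset.mem_insert, not_and, not_not] at hy
        rcases hy.2 hy.1.1 with rfl | h'
        · exact G.loopless.irrefl _ h
        · exact hy.1.2 h'
      · intro x hx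
        refine Finset.card_eq_zero.2 (Finset.filter_eq_empty_iff.2 fun {y} hy h => ?_)
        simp only [Finset.mem_sdiff, Finset.mem_insert, not_or] at hy
        exact hy.2.1 (hout x hx y (Finset.mem_sdiff.2 ⟨hy.1, hy.2.2⟩) h)
    rcases hkd.eq_or_lt with hkd | hkd
    · -- degree `d` on all of `K` contradicts the sparsity of `insert z K`
      exfalso
      have h1 := hsp (insert z K) (Finset.insert_nonempty _ _)
      have h2 : ∑ x ∈ insert z K, degIn G W x = ∑ x ∈ insert z K, degIn G (insert z K) x +
          ∑ x ∈ insert z K, degIn G (W \ insert z K) x := by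
        rw [← Finset.sum_add_distrib]
        exact Finset.sum_congr rfl fun x _ => degIn_add_sdiff hDW x
      rw [hsumD1, hsumD2] at h2
      rw [hcardD, mul_add] at h1
      rw [hkd] at h2
      omega
    have hkd' : d = k + 1 := by omega
    -- many edges from `z` to `K` mean few edges from `z` to the rest, as `z` has degree at most `d`
    by_cases hcase : 4 * m ≤ 3 * K.card
    · refine ⟨K, hKB.trans hBW, ⟨y0, hy0⟩, ?_⟩
      rw [hsum1, hsum2]
      have : 4 * d - 1 = 4 * k + 3 := by omega
      rw [this]
      nlinarith
    · refine ⟨insert z K, hDW, Finset.insert_nonempty _ _, ?_⟩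
      rw [hsumD1, hsumD2, hcardD]
      have : 4 * d - 1 = 4 * k + 3 := by omega
      rw [this]
      nlinarith
  · push Not at hcut
    obtain ⟨y0, hy0⟩ := hBne
    set k := degIn G B y0 with hk
    have hconst : ∀ y ∈ B, degIn G B y = k := fun y hy =>
      hB.eq_of_le (fun x hx y hy hxy => hB.degIn_le_degIn hBbad hx hy hxy (hcut x hx)) hy hy0
    have hsum : ∑ x ∈ B, degIn G B x = k * B.card := by
      rw [Finset.sum_congr rfl hconst, Finset.sum_const, smul_eq_mul, mul_comm]
    have hkd : k < d := by
      by_contra hge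
      have := hsp B ⟨y0, hy0⟩
      rw [hsum] at this
      have := Nat.mul_le_mul_right B.card (not_lt.1 hge)
      omega
    refine ⟨B, hBW, ⟨y0, hy0⟩, ?_⟩
    have h0 : ∑ x ∈ B, degIn G (W \ B) x = 0 := Finset.sum_eq_zero fun x hx =>
      Finset.card_eq_zero.2 (Finset.filter_eq_empty_iff.2 fun {y} hy h => hBcl x hx y hy h)
    rw [Finset.sum_congr rfl hdB, hsum, h0]
    calc 4 * (k * B.card + 0) = (4 * k) * B.card := by ring
      _ ≤ (4 * d - 1) * B.card := Nat.mul_le_mul_right _ (by omega)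

/-- A connected set of maximum degree `d` in a sparse graph that is not degree-choosable has at most
`d / 2 - 1 / 8` times as many edges as vertices. This is a weak form of Gallai's bound. -/
lemma sum_degIn_le_of_not_degreeChoosable [Nonempty Color] {d : ℕ} (hd : 4 ≤ d)
    (hsp : DegreeSparse d G) {U : Finset V} (hU : ConnectedOn G U)
    (hdeg : ∀ x ∈ U, degIn G U x ≤ d) (hbad : ¬ DegreeChoosable Color G U) :
    4 * ∑ x ∈ U, degIn G U x ≤ (4 * d - 1) * U.card :=
  sum_degIn_le_of_pieces U fun _ hW hWne => exists_sparse_piece hd hsp hWne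
    (fun x hx => (degIn_mono hW x).trans (hdeg x (hW hx)))
    fun _ hBW hBne _ h => hbad (h.of_subset hU (hBW.trans hW) hBne)

end Density

/-! ### Balls and clusters -/

section Clusters
variable {V : Type*} {Color : Type*} {G : SimpleGraph V}

/-- There is a walk of length at most `t` from `x` to `y`. -/
def Within (G : SimpleGraph V) (t : ℕ) (x y : V) : Prop := ∃ p : G.Walk x y, p.length ≤ t

lemma Within.refl (t : ℕ) (x : V) : Within G t x x := ⟨.nil, Nat.zero_le _⟩

lemma Within.mono {s t : ℕ} (h : s ≤ t) {x y : V} (hw : Within G s x y) : Within G t x y :=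
  ⟨hw.choose, hw.choose_spec.trans h⟩

lemma Within.mono_graph {G' : SimpleGraph V} (h : G ≤ G') {t : ℕ} {x y : V}
    (hw : Within G t x y) : Within G' t x y := by
  obtain ⟨p, hp⟩ := hw
  exact ⟨p.mapLe h, by simpa using hp⟩

lemma Within.symm {t : ℕ} {x y : V} (hw : Within G t x y) : Within G t y x := by
  obtain ⟨p, hp⟩ := hw
  exact ⟨p.reverse, by simpa using hp⟩

lemma Within.trans {s t : ℕ} {x y z : V} (h : Within G s x y) (h' : Within G t y z) :
    Within G (s + t) x z := by
  obtain ⟨p, hp⟩ := h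
  obtain ⟨q, hq⟩ := h'
  exact ⟨p.append q, by rw [SimpleGraph.Walk.length_append]; omega⟩

lemma within_of_adj {x y : V} (h : G.Adj x y) : Within G 1 x y := ⟨.cons h .nil, by simp⟩

lemma within_zero {x y : V} : Within G 0 x y ↔ x = y := by
  constructor
  · rintro ⟨p, hp⟩
    exact SimpleGraph.Walk.eq_of_length_eq_zero (Nat.le_zero.1 hp)
  · rintro rfl
    exact Within.refl _ _

lemma within_succ {t : ℕ} {x z : V} :
    Within G (t + 1) x z ↔ x = z ∨ ∃ y, G.Adj x y ∧ Within G t y z := by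
  constructor
  · rintro ⟨p, hp⟩
    cases p with
    | nil => exact Or.inl rfl
    | cons h q => exact Or.inr ⟨_, h, q, by simpa using hp⟩
  · rintro (rfl | ⟨y, hy, q, hq⟩)
    · exact Within.refl _ _
    · exact ⟨.cons hy q, by simpa using hq⟩

lemma within_succ' {t : ℕ} {x z : V} :
    Within G (t + 1) x z ↔ x = z ∨ ∃ y, Within G t x y ∧ G.Adj y z := by
  constructor
  · intro h
    rcases within_succ.1 h.symm with h | ⟨y, hy, h⟩
    · exact Or.inl h.symm
    · exact Or.inr ⟨y, h.symm, hy.symm⟩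
  · rintro (rfl | ⟨y, hy, h⟩)
    · exact Within.refl _ _
    · exact hy.trans (within_of_adj h)

/-- The graph on the same vertices that keeps only the edges inside `U`. -/
def restrictTo (G : SimpleGraph V) (U : Finset V) : SimpleGraph V where
  Adj x y := G.Adj x y ∧ x ∈ U ∧ y ∈ U
  symm := ⟨fun _ _ h => ⟨h.1.symm, h.2.2, h.2.1⟩⟩
  loopless := ⟨fun x h => G.loopless.irrefl x h.1⟩

lemma restrictTo_le (U : Finset V) : restrictTo G U ≤ G := fun _ _ h => h.1

lemma Within.mem_of_closed {U X : Finset V} {t : ℕ} {v y : V}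
    (hX : ∀ x ∈ X, ∀ y ∈ U \ X, ¬ G.Adj x y) (hv : v ∈ X)
    (h : Within (restrictTo G U) t v y) : y ∈ X := by
  induction t generalizing v with
  | zero => exact within_zero.1 h ▸ hv
  | succ t ih =>
    rcases within_succ.1 h with rfl | ⟨w, hvw, h⟩
    · exact hv
    · refine ih ?_ h
      by_contra hw
      exact hX v hv w (Finset.mem_sdiff.2 ⟨hvw.2.2, hw⟩) hvw.1

lemma connectedOn_of_center {U : Finset V} {r : ℕ} {v : V} (hv : v ∈ U)
    (h : ∀ y ∈ U, Within (restrictTo G U) r v y) : ConnectedOn G U := by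
  intro X hXU hX hne
  by_contra! hcon
  by_cases hvX : v ∈ X
  · exact hne (hXU.antisymm fun y hy => (h y hy).mem_of_closed hcon hvX)
  · obtain ⟨x, hx⟩ := hX
    have : x ∈ U \ X := (h x (hXU hx)).mem_of_closed (X := U \ X) (fun a ha b hb hab => by
      simp only [Finset.mem_sdiff, not_and, not_not] at hb
      exact hcon b (hb.2 hb.1) a ha hab.symm) (by simp [hv, hvX])
    exact (Finset.mem_sdiff.1 this).2 hx

/-- A ball of the graph induced by `S` has the same center and radius in its own induced graph. -/
lemma within_restrictTo_ball {S : Finset V} {i j : ℕ} (hji : j ≤ i) {v y : V}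
    (h : Within (restrictTo G S) j v y) :
    Within (restrictTo G (S.filter (Within (restrictTo G S) i v))) j v y := by
  induction j generalizing y with
  | zero => exact within_zero.2 (within_zero.1 h)
  | succ j ih =>
    rcases within_succ'.1 h with rfl | ⟨w, hvw, hwy⟩
    · exact Within.refl _ _
    · refine within_succ'.2 (Or.inr ⟨w, ih (by omega) hvw, hwy.1, ?_, ?_⟩)
      · exact Finset.mem_filter.2 ⟨hwy.2.1, hvw.mono (by omega)⟩
      · exact Finset.mem_filter.2 ⟨hwy.2.2, h.mono hji⟩

lemma two_mul_pow_le_succ_pow {m : ℕ} (hm : 1 ≤ m) : 2 * m ^ m ≤ (m + 1) ^ m := by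
  have h := one_add_mul_le_pow (a := (1 / m : ℝ)) (by
    have : (0 : ℝ) ≤ 1 / m := by positivity
    linarith) m
  have hm' : (0 : ℝ) < m := by exact_mod_cast hm
  have h2 : (1 + (1 / m : ℝ)) ^ m * (m : ℝ) ^ m = ((m : ℝ) + 1) ^ m := by
    rw [← mul_pow]
    congr 1
    field_simp
  have h3 : (m : ℝ) * (1 / m) = 1 := by field_simp
  have h4 : (2 : ℝ) * m ^ m ≤ (m + 1) ^ m := by
    rw [← h2]
    have : (0 : ℝ) < (m : ℝ) ^ m := by positivity
    rw [h3] at h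
    nlinarith
  exact_mod_cast h4

/-- A sequence that grows by the factor `1 + 1 / m` in every step doubles every `m` steps. -/
lemma two_pow_le_of_growth {m l : ℕ} (hm : 1 ≤ m) {b : ℕ → ℕ} (h0 : 1 ≤ b 0)
    (h : ∀ i < m * l, (m + 1) * b i ≤ m * b (i + 1)) : 2 ^ l ≤ b (m * l) := by
  have key : ∀ i ≤ m * l, (m + 1) ^ i ≤ m ^ i * b i := by
    intro i
    induction i with
    | zero => intro _; simpa using h0
    | succ i ih =>
      intro hi
      calc (m + 1) ^ (i + 1) = (m + 1) * (m + 1) ^ i := by ring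
        _ ≤ (m + 1) * (m ^ i * b i) := Nat.mul_le_mul_left _ (ih (by omega))
        _ = m ^ i * ((m + 1) * b i) := by ring
        _ ≤ m ^ i * (m * b (i + 1)) := Nat.mul_le_mul_left _ (h i (by omega))
        _ = m ^ (i + 1) * b (i + 1) := by ring
  have h1 := key _ le_rfl
  have h2 : 2 ^ l * m ^ (m * l) ≤ (m + 1) ^ (m * l) := by
    rw [pow_mul, pow_mul, ← mul_pow]
    exact Nat.pow_le_pow_left (two_mul_pow_le_succ_pow hm) _
  have h3 : 0 < m ^ (m * l) := by positivity
  have h4 := h2.trans h1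
  rw [mul_comm] at h4
  exact Nat.le_of_mul_le_mul_left h4 h3

/-- A nonempty set of maximum degree `d` contains a ball of logarithmic radius that few edges
leave. -/
lemma exists_ball_few_leaving {d l : ℕ} (hd : 1 ≤ d) {S : Finset V} (hS : S.Nonempty)
    (hcard : S.card < 2 ^ l) (hdeg : ∀ x ∈ S, degIn G S x ≤ d) :
    ∃ U ⊆ S, (∃ v ∈ U, ∀ y ∈ U, Within (restrictTo G U) (16 * d * l) v y) ∧
      16 * ∑ x ∈ U, degIn G (S \ U) x ≤ U.card := by
  obtain ⟨v, hv⟩ := hS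
  set b : ℕ → Finset V := fun i => S.filter (Within (restrictTo G S) i v) with hb
  have hbS (i : ℕ) : b i ⊆ S := Finset.filter_subset _ _
  by_contra! hcon
  have hgrow : ∀ i < 16 * d * l, (16 * d + 1) * (b i).card ≤ 16 * d * (b (i + 1)).card := by
    intro i hi
    have h1 := hcon (b i) (hbS i) ⟨v, Finset.mem_filter.2 ⟨hv, Within.refl _ _⟩, fun y hy =>
      (within_restrictTo_ball le_rfl (Finset.mem_filter.1 hy).2).mono hi.le⟩
    have hmono : b i ⊆ b (i + 1) := fun x hx => by
      have := Finset.mem_filter.1 hx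
      exact Finset.mem_filter.2 ⟨this.1, this.2.mono (Nat.le_succ i)⟩
    have h2 : ∑ x ∈ b i, degIn G (S \ b i) x = ∑ x ∈ b i, degIn G (b (i + 1) \ b i) x := by
      refine Finset.sum_congr rfl fun x hx => degIn_eq_of_no_adj
        (Finset.sdiff_subset_sdiff (hbS _) subset_rfl) fun y hy hxy => ?_
      have hx' := Finset.mem_filter.1 hx
      simp only [Finset.mem_sdiff, not_and, not_not] at hy
      refine hy.1.2 (hy.2 (Finset.mem_filter.2 ⟨hy.1.1, ?_⟩))
      exact within_succ'.2 (Or.inr ⟨x, hx'.2, hxy, hx'.1, hy.1.1⟩)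
    have h3 : ∑ x ∈ b i, degIn G (b (i + 1) \ b i) x ≤ (b (i + 1) \ b i).card * d := by
      rw [sum_degIn_comm]
      refine Finset.sum_le_card_nsmul _ _ _ fun y hy => ?_
      exact (degIn_mono (hbS i) y).trans (hdeg y (hbS _ (Finset.mem_sdiff.1 hy).1))
    have h4 := Finset.card_sdiff_add_card_eq_card hmono
    rw [← h4]
    rw [h2] at h1
    nlinarith
  have h0 : 1 ≤ (b 0).card :=
    Finset.card_pos.2 ⟨v, Finset.mem_filter.2 ⟨hv, Within.refl _ _⟩⟩
  have h1 := two_pow_le_of_growth (m := 16 * d) (l := l) (b := fun i => (b i).card) (by omega)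
    h0 hgrow
  have h2 := Finset.card_le_card (hbS (16 * d * l))
  omega

/-- `U` can be colored last within `W`: whatever colors the vertices of `W \ U` have, lists of
size `d` leave enough colors for a proper coloring of `U`. -/
def ColorableLast (Color : Type*) (d : ℕ) (G : SimpleGraph V) (W U : Finset V) : Prop :=
  ∀ L : V → Finset Color, (∀ x ∈ U, d ≤ (L x).card + degIn G (W \ U) x) → ListColorable G U L

/-- The sets of vertices that are removed from the set `W` of remaining vertices: connected sets
of radius at most `r`, of degrees at most `d` in `W`, that can be colored last. -/
structure IsCluster (Color : Type*) (d r : ℕ) (G : SimpleGraph V) (W U : Finset V) : Prop where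
  subset : U ⊆ W
  degIn_le : ∀ y ∈ U, degIn G W y ≤ d
  center : ∃ v ∈ U, ∀ y ∈ U, Within (restrictTo G U) r v y
  colorableLast : ColorableLast Color d G W U

/-- The vertices of `W` that lie in a cluster. -/
def clustered (Color : Type*) (d r : ℕ) (G : SimpleGraph V) (W : Finset V) : Finset V :=
  W.filter fun x => ∃ U, x ∈ U ∧ IsCluster Color d r G W U

lemma mem_clustered {d r : ℕ} {W : Finset V} {x : V} : x ∈ clustered Color d r G W ↔
    x ∈ W ∧ ∃ U, x ∈ U ∧ IsCluster Color d r G W U := Finset.mem_filter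

lemma clustered_subset {d r : ℕ} {W : Finset V} : clustered Color d r G W ⊆ W :=
  Finset.filter_subset _ _

/-- A constant fraction (for fixed `d`) of the vertices of `W` lies in clusters. The other vertices
of degree at most `d` have degree exactly `d`, and cutting the graph that they induce into balls,
none of which is degree-choosable, shows that they have many edges to the rest of `W`. By sparsity
there are few of these, unless many vertices are clustered. -/
lemma card_le_card_clustered [Nonempty Color] {d l : ℕ} (hd : 4 ≤ d) (hsp : DegreeSparse d G)
    {W : Finset V} (hcard : W.card < 2 ^ l) :
    W.card ≤ 14 * d ^ 2 * (clustered Color d (16 * d * l) G W).card := by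
  rcases W.eq_empty_or_nonempty with rfl | hWne
  · simp
  set A := clustered Color d (16 * d * l) G W with hA
  set P := W.filter fun x => d < degIn G W x with hP
  set S := W.filter fun x => x ∉ A ∧ degIn G W x ≤ d with hS
  have hAW : A ⊆ W := Finset.filter_subset _ _
  have hSW : S ⊆ W := Finset.filter_subset _ _
  have hAdeg : ∀ x ∈ A, degIn G W x ≤ d := fun x hx => by
    obtain ⟨-, U, hxU, hU⟩ := Finset.mem_filter.1 hx
    exact hU.degIn_le x hxU
  have hSdeg : ∀ x ∈ S, degIn G W x = d := by
    intro x hx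
    obtain ⟨hxW, hxA, hxd⟩ := Finset.mem_filter.1 hx
    refine le_antisymm hxd (not_lt.1 fun hlt => hxA (Finset.mem_filter.2 ⟨hxW, {x}, by simp, ?_⟩))
    refine ⟨by simpa using hxW, by simpa using hxd, ⟨x, by simp, ?_⟩, fun L hL => ?_⟩
    · intro y hy
      rw [Finset.mem_singleton.1 hy]
      exact Within.refl _ _
    · have h1 := hL x (by simp)
      have h2 := degIn_mono (G := G) (Finset.sdiff_subset : W \ {x} ⊆ W) x
      exact listColorable_singleton (by omega)
  have hSsum : 8 * ∑ x ∈ S, degIn G S x ≤ (8 * d - 1) * S.card := by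
    refine sum_degIn_le_of_pieces S fun S' hS' hS'ne => ?_
    have hdeg' : ∀ x ∈ S', degIn G S' x ≤ d := fun x hx =>
      (degIn_mono (hS'.trans hSW) x).trans (hSdeg x (hS' hx)).le
    obtain ⟨U, hUS, ⟨v, hv, hcen⟩, hfew⟩ := exists_ball_few_leaving (l := l) (d := d) (by omega)
      hS'ne ((Finset.card_le_card (hS'.trans hSW)).trans_lt hcard) hdeg'
    refine ⟨U, hUS, ⟨v, hv⟩, ?_⟩
    have hUW : U ⊆ W := hUS.trans (hS'.trans hSW)
    have hUbad : ¬ DegreeChoosable Color G U := by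
      intro hch
      refine (Finset.mem_filter.1 (hS' (hUS hv))).2.1 (Finset.mem_filter.2 ⟨hUW hv, U, hv, hUW,
        fun y hy => (hSdeg y (hS' (hUS hy))).le, ⟨v, hv, hcen⟩, fun L hL => hch L fun x hx => ?_⟩)
      have h1 := hL x hx
      have h2 := degIn_add_sdiff (G := G) hUW x
      have h3 := hSdeg x (hS' (hUS hx))
      omega
    have h1 := sum_degIn_le_of_not_degreeChoosable hd hsp (connectedOn_of_center hv hcen)
      (fun x hx => (degIn_mono hUS x).trans (hdeg' x (hUS hx))) hUbad
    have h2 : ∑ x ∈ U, degIn G S' x = ∑ x ∈ U, degIn G U x + ∑ x ∈ U, degIn G (S' \ U) x := by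
      rw [← Finset.sum_add_distrib]
      exact Finset.sum_congr rfl fun x _ => degIn_add_sdiff hUS x
    rw [h2]
    obtain ⟨e, rfl⟩ : ∃ e, d = e + 1 := ⟨d - 1, by omega⟩
    have h3 : 4 * (e + 1) - 1 = 4 * e + 3 := by omega
    have h4 : 8 * (e + 1) - 1 = 8 * e + 7 := by omega
    rw [h3] at h1
    rw [h4]
    nlinarith
  have hrest : W \ S = A ∪ P := by
    ext x
    simp only [hS, hP, Finset.mem_sdiff, Finset.mem_filter, Finset.mem_union, not_and, not_le]
    constructor
    · rintro ⟨hx, h⟩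
      by_cases hxA : x ∈ A
      · exact Or.inl hxA
      · exact Or.inr ⟨hx, h hx hxA⟩
    · rintro (h | h)
      · exact ⟨hAW h, fun _ h' => absurd h h'⟩
      · exact ⟨h.1, fun _ _ => h.2⟩
  have hdisj : Disjoint A P := by
    rw [Finset.disjoint_left]
    intro x hx hx'
    have := (Finset.mem_filter.1 hx').2
    have := hAdeg x hx
    omega
  have hcardW : S.card + (A.card + P.card) = W.card := by
    rw [← Finset.card_union_of_disjoint hdisj, ← hrest, add_comm,
      Finset.card_sdiff_add_card_eq_card hSW]
  have hsumW : ∑ x ∈ W, degIn G W x =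
      (∑ x ∈ A, degIn G W x + ∑ x ∈ P, degIn G W x) + d * S.card := by
    rw [← Finset.sum_union hdisj, ← hrest, ← Finset.sum_sdiff hSW, Finset.sum_congr rfl hSdeg,
      Finset.sum_const, smul_eq_mul, mul_comm d]
  have hsumS : d * S.card = ∑ x ∈ S, degIn G S x + ∑ x ∈ S, degIn G (W \ S) x := by
    rw [← Finset.sum_add_distrib, ← Finset.sum_congr rfl fun x _ => degIn_add_sdiff hSW x,
      Finset.sum_congr rfl hSdeg, Finset.sum_const, smul_eq_mul, mul_comm d]
  have hcross : ∑ x ∈ S, degIn G (W \ S) x ≤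
      ∑ x ∈ A, degIn G W x + ∑ x ∈ P, degIn G W x := by
    rw [sum_degIn_comm, hrest, Finset.sum_union hdisj]
    gcongr <;> exact degIn_mono hSW _
  have hsumA : ∑ x ∈ A, degIn G W x ≤ A.card * d := Finset.sum_le_card_nsmul _ _ _ hAdeg
  have hsumP : P.card * (d + 1) ≤ ∑ x ∈ P, degIn G W x :=
    Finset.card_nsmul_le_sum P (degIn G W) (d + 1) fun x hx => (Finset.mem_filter.1 hx).2
  have hspW := hsp W hWne
  rw [← hcardW, hsumW] at hspW
  generalize (∑ x ∈ P, degIn G W x) = sP at *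
  generalize (∑ x ∈ A, degIn G W x) = sA at *
  generalize (∑ x ∈ S, degIn G S x) = sS at *
  generalize (∑ x ∈ S, degIn G (W \ S) x) = sX at *
  have hsP : sP ≤ d * A.card + d * P.card := by
    simp only [mul_add] at hspW
    omega
  have hPc : P.card ≤ d * A.card := by nlinarith
  have hsP' : sP ≤ d * A.card + d * (d * A.card) :=
    hsP.trans (Nat.add_le_add_left (Nat.mul_le_mul_left _ hPc) _)
  have hSc : S.card ≤ 8 * sX := by
    obtain ⟨e, rfl⟩ : ∃ e, d = e + 1 := ⟨d - 1, by omega⟩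
    have h4 : 8 * (e + 1) - 1 = 8 * e + 7 := by omega
    rw [h4] at hSsum
    nlinarith
  have hd2 : 17 * d + 1 ≤ 6 * d ^ 2 := by nlinarith
  rw [← hcardW]
  calc S.card + (A.card + P.card)
      ≤ 8 * (A.card * d + (d * A.card + d * (d * A.card))) + (A.card + d * A.card) := by omega
    _ = (17 * d + 1 + 8 * d ^ 2) * A.card := by ring
    _ ≤ 14 * d ^ 2 * A.card := Nat.mul_le_mul_right _ (by omega)

end Clusters

/-! ### Functions that are computable in a given number of rounds -/

section Locality
variable {V : Type*} {G G' : SimpleGraph V} {Z : ℕ → Set V}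

/-- The sets `Z t` witness that `G` and `G'` look the same from the vertices of `Z t` up to
distance `t`. A function of the graph is computable in `t` rounds when its values for `G` and `G'`
agree on `Z t`, for all such `G`, `G'` and `Z` (and for inputs that agree on `Z 0`). -/
structure Agreement (G G' : SimpleGraph V) (Z : ℕ → Set V) : Prop where
  succ_subset : ∀ t, Z (t + 1) ⊆ Z t
  adj_iff : ∀ {t x}, x ∈ Z (t + 1) → ∀ y, G.Adj x y ↔ G'.Adj x y
  mem_of_adj : ∀ {t x y}, x ∈ Z (t + 1) → G.Adj x y → y ∈ Z t

namespace Agreement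

lemma symm (h : Agreement G G' Z) : Agreement G' G Z :=
  ⟨h.succ_subset, fun hx y => (h.adj_iff hx y).symm,
    fun hx hxy => h.mem_of_adj hx ((h.adj_iff hx _).2 hxy)⟩

lemma antitone (h : Agreement G G' Z) : Antitone Z := antitone_nat_of_succ_le h.succ_subset

lemma mem_of_within (h : Agreement G G' Z) {s t : ℕ} {x y : V} (hx : x ∈ Z (t + s))
    (hxy : Within G s x y) : y ∈ Z t := by
  induction s generalizing x with
  | zero => exact within_zero.1 hxy ▸ hx
  | succ s ih =>
    rcases within_succ.1 hxy with rfl | ⟨w, hxw, hw⟩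
    · exact h.antitone (Nat.le_add_right _ _) hx
    · exact ih (h.mem_of_adj hx hxw) hw

lemma within_iff (h : Agreement G G' Z) {t : ℕ} {x : V} (hx : x ∈ Z t) (y : V) :
    Within G t x y ↔ Within G' t x y := by
  induction t generalizing x with
  | zero => rw [within_zero, within_zero]
  | succ t ih =>
    rw [within_succ, within_succ]
    refine or_congr_right (exists_congr fun w => ?_)
    rw [← h.adj_iff hx w]
    exact and_congr_right fun hw => ih (h.mem_of_adj hx hw)

lemma degIn_eq (h : Agreement G G' Z) {t : ℕ} {W W' : Finset V}
    (hW : ∀ x ∈ Z t, x ∈ W ↔ x ∈ W') {x : V} (hx : x ∈ Z (t + 1)) :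
    degIn G W x = degIn G' W' x := by
  unfold degIn
  congr 1
  ext y
  simp only [Finset.mem_filter]
  rw [← h.adj_iff hx y]
  exact and_congr_left fun hy => hW y (h.mem_of_adj hx hy)

end Agreement

/-- The graph that keeps the edges between vertices of the same level. -/
def sameLevel {α : Type*} (G : SimpleGraph V) (f : V → α) : SimpleGraph V where
  Adj x y := G.Adj x y ∧ f x = f y
  symm := ⟨fun _ _ h => ⟨h.1.symm, h.2.symm⟩⟩
  loopless := ⟨fun x h => G.loopless.irrefl x h.1⟩

lemma Agreement.sameLevel {α : Type*} {f f' : V → α} {t : ℕ} (h : Agreement G G' Z)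
    (hf : Set.EqOn f f' (Z t)) :
    Agreement (sameLevel G f) (sameLevel G' f') fun s => Z (t + s) where
  succ_subset s := h.succ_subset _
  adj_iff {s x} hx y := by
    change G.Adj x y ∧ _ ↔ G'.Adj x y ∧ _
    rw [← h.adj_iff hx y]
    refine and_congr_right fun hy => ?_
    rw [hf (h.antitone (Nat.le_add_right t (s + 1)) hx),
      hf (h.antitone (Nat.le_add_right t s) (h.mem_of_adj hx hy))]
  mem_of_adj hx hxy := h.mem_of_adj hx hxy.1

lemma IsCluster.within {Color : Type*} {d r : ℕ} {W U : Finset V}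
    (h : IsCluster Color d r G W U) {x y : V} (hx : x ∈ U) (hy : y ∈ U) :
    Within (restrictTo G U) (2 * r) x y := by
  obtain ⟨v, -, hc⟩ := h.center
  rw [two_mul]
  exact (hc x hx).symm.trans (hc y hy)

lemma Agreement.isCluster {Color : Type*} {d r t : ℕ} {W W' U : Finset V}
    (h : Agreement G G' Z) (hW : ∀ x ∈ Z t, x ∈ W ↔ x ∈ W') {x : V}
    (hx : x ∈ Z (t + (2 * r + 1))) (hxU : x ∈ U) (hU : IsCluster Color d r G W U) :
    IsCluster Color d r G' W' U := by
  have hZ : ∀ y ∈ U, y ∈ Z (t + 1) := fun y hy =>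
    h.mem_of_within (by rwa [add_assoc, add_comm 1])
      ((hU.within hxU hy).mono_graph (restrictTo_le U))
  have hadj : ∀ y ∈ U, ∀ z, G.Adj y z ↔ G'.Adj y z := fun y hy => h.adj_iff (hZ y hy)
  have hres : restrictTo G U = restrictTo G' U := by
    ext y z
    change G.Adj y z ∧ _ ↔ G'.Adj y z ∧ _
    by_cases hy : y ∈ U
    · rw [hadj y hy]
    · simp [hy]
  refine ⟨fun y hy => (hW y (h.succ_subset _ (hZ y hy))).1 (hU.subset hy), fun y hy => ?_, ?_, ?_⟩
  · rw [← h.degIn_eq hW (hZ y hy)]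
    exact hU.degIn_le y hy
  · rw [← hres]
    exact hU.center
  · intro L hL
    obtain ⟨c, hc, hc'⟩ := hU.colorableLast L fun y hy => by
      rw [h.degIn_eq (W' := W' \ U) (fun z hz => by simp [hW z hz]) (hZ y hy)]
      exact hL y hy
    exact ⟨c, hc, fun y hy z hz hyz => hc' y hy z hz ((hadj y hy z).2 hyz)⟩

lemma Agreement.isCluster_iff {Color : Type*} {d r t : ℕ} {W W' : Finset V}
    (h : Agreement G G' Z) (hW : ∀ x ∈ Z t, x ∈ W ↔ x ∈ W') {x : V}
    (hx : x ∈ Z (t + (2 * r + 1))) (U : Finset V) :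
    (x ∈ U ∧ IsCluster Color d r G W U) ↔ (x ∈ U ∧ IsCluster Color d r G' W' U) :=
  and_congr_right fun hxU => ⟨h.isCluster hW hx hxU,
    h.symm.isCluster (fun y hy => (hW y hy).symm) hx hxU⟩

end Locality

/-! ### Repeated removal of the clusters -/

section Peeling
variable {V : Type*} [Fintype V] {Color : Type*} {G G' : SimpleGraph V} {Z : ℕ → Set V}

/-- The vertices of level at least `i`. -/
def remaining (f : V → ℕ) (i : ℕ) : Finset V := Finset.univ.filter fun x => i ≤ f x

lemma mem_remaining {f : V → ℕ} {i : ℕ} {x : V} : x ∈ remaining f i ↔ i ≤ f x := by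
  simp [remaining]

/-- The number of the step in which a vertex is removed when, `i` times, all vertices that lie in
clusters of the remaining graph are removed; it is `i` for the vertices that remain. -/
def peelLevel (Color : Type*) (d r : ℕ) (G : SimpleGraph V) : ℕ → V → ℕ
  | 0, _ => 0
  | i + 1, x => if i ≤ peelLevel Color d r G i x ∧
      ¬ ∃ U, x ∈ U ∧ IsCluster Color d r G (remaining (peelLevel Color d r G i) i) U
    then i + 1 else peelLevel Color d r G i x

variable {d r : ℕ}

lemma peelLevel_le (i : ℕ) (x : V) : peelLevel Color d r G i x ≤ i := by
  induction i with
  | zero => exact le_rfl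
  | succ i ih =>
    rw [peelLevel]
    split_ifs
    · exact le_rfl
    · omega

lemma le_peelLevel_iff {i j : ℕ} (hij : i ≤ j) (x : V) :
    i ≤ peelLevel Color d r G j x ↔ i ≤ peelLevel Color d r G i x := by
  induction j, hij using Nat.le_induction with
  | base => rfl
  | succ j hij ih =>
    rw [← ih, peelLevel]
    split_ifs with h
    · exact ⟨fun _ => hij.trans h.1, fun _ => by omega⟩
    · rfl

lemma remaining_peelLevel {i j : ℕ} (hij : i ≤ j) :
    remaining (peelLevel Color d r G j) i = remaining (peelLevel Color d r G i) i := by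
  ext x
  rw [mem_remaining, mem_remaining, le_peelLevel_iff hij]

lemma succ_le_peelLevel_iff {i j : ℕ} (hij : i < j) (x : V) :
    i + 1 ≤ peelLevel Color d r G j x ↔ i ≤ peelLevel Color d r G j x ∧
      x ∉ clustered Color d r G (remaining (peelLevel Color d r G j) i) := by
  rw [le_peelLevel_iff hij, le_peelLevel_iff hij.le, remaining_peelLevel hij.le, peelLevel,
    mem_clustered, mem_remaining]
  have := peelLevel_le (Color := Color) (d := d) (r := r) (G := G) i x
  split_ifs with h
  · exact ⟨fun _ => ⟨h.1, fun h' => h.2 h'.2⟩, fun _ => le_rfl⟩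
  · constructor
    · intro h'
      omega
    · rintro ⟨h1, h2⟩
      refine absurd ⟨h1, fun h' => h2 ⟨h1, h'⟩⟩ h

lemma mem_clustered_of_peelLevel_eq {i j : ℕ} (hij : i < j) {x : V}
    (hx : peelLevel Color d r G j x = i) :
    x ∈ clustered Color d r G (remaining (peelLevel Color d r G j) i) := by
  by_contra h
  have := (succ_le_peelLevel_iff hij x).2 ⟨hx.ge, h⟩
  omega

lemma peelLevel_eq_of_mem_clustered {i j : ℕ} (hij : i < j) {x : V}
    (hx : x ∈ clustered Color d r G (remaining (peelLevel Color d r G j) i)) :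
    peelLevel Color d r G j x = i := by
  have h1 := mem_remaining.1 (clustered_subset hx)
  have h2 : ¬ i + 1 ≤ peelLevel Color d r G j x := fun h =>
    ((succ_le_peelLevel_iff hij x).1 h).2 hx
  omega

/-- A sequence that shrinks by the factor `1 - 1 / m` in every step halves every `m` steps. -/
lemma two_pow_mul_le_of_decay {m l : ℕ} (hm : 2 ≤ m) {b : ℕ → ℕ}
    (h : ∀ i < m * l, m * b (i + 1) ≤ (m - 1) * b i) : 2 ^ l * b (m * l) ≤ b 0 := by
  obtain ⟨e, rfl⟩ : ∃ e, m = e + 1 := ⟨m - 1, by omega⟩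
  simp only [Nat.add_sub_cancel] at h
  have key : ∀ i ≤ (e + 1) * l, (e + 1) ^ i * b i ≤ e ^ i * b 0 := by
    intro i
    induction i with
    | zero => intro _; simp
    | succ i ih =>
      intro hi
      calc (e + 1) ^ (i + 1) * b (i + 1) = (e + 1) ^ i * ((e + 1) * b (i + 1)) := by ring
        _ ≤ (e + 1) ^ i * (e * b i) := Nat.mul_le_mul_left _ (h i (by omega))
        _ = e * ((e + 1) ^ i * b i) := by ring
        _ ≤ e * (e ^ i * b 0) := Nat.mul_le_mul_left _ (ih (by omega))
        _ = e ^ (i + 1) * b 0 := by ring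
  have h1 := key _ le_rfl
  have h2 : 2 ^ l * e ^ ((e + 1) * l) ≤ (e + 1) ^ ((e + 1) * l) := by
    rw [pow_mul, pow_mul, ← mul_pow]
    refine Nat.pow_le_pow_left ?_ _
    have := two_mul_pow_le_succ_pow (m := e) (by omega)
    rw [pow_succ, pow_succ, ← mul_assoc]
    exact Nat.mul_le_mul this (Nat.le_succ e)
  have h3 : 0 < e ^ ((e + 1) * l) := by
    have : 0 < e := by omega
    positivity
  have h4 := (Nat.mul_le_mul_right (b ((e + 1) * l)) h2).trans h1
  refine Nat.le_of_mul_le_mul_left (?_ : e ^ ((e + 1) * l) * _ ≤ _) h3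
  calc _ = 2 ^ l * e ^ ((e + 1) * l) * b ((e + 1) * l) := by ring
    _ ≤ _ := h4

/-- After `O(d ^ 2 log n)` steps, no vertex remains. -/
lemma peelLevel_lt [Nonempty Color] {l : ℕ} (hd : 4 ≤ d) (hsp : DegreeSparse d G)
    (hcard : Fintype.card V < 2 ^ l) (x : V) :
    peelLevel Color d (16 * d * l) G (14 * d ^ 2 * l) x < 14 * d ^ 2 * l := by
  set J := 14 * d ^ 2 * l with hJ
  set f := peelLevel Color d (16 * d * l) G J with hf
  have h := two_pow_mul_le_of_decay (m := 14 * d ^ 2) (l := l) (by nlinarith)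
    (b := fun i => (remaining f i).card) (fun i hi => by
      have hsub : clustered Color d (16 * d * l) G (remaining f i) ⊆ remaining f i :=
        clustered_subset
      have h1 := card_le_card_clustered (Color := Color) hd hsp (l := l) (W := remaining f i)
        ((Finset.card_le_univ _).trans_lt hcard)
      have h2 : remaining f (i + 1) =
          remaining f i \ clustered Color d (16 * d * l) G (remaining f i) := by
        ext y
        rw [Finset.mem_sdiff, mem_remaining, mem_remaining, hf, succ_le_peelLevel_iff hi]
      have h3 := Finset.card_sdiff_add_card_eq_card hsub
      rw [← h2] at h3
      obtain ⟨m, hm⟩ : ∃ m, 14 * d ^ 2 = m + 1 := ⟨14 * d ^ 2 - 1, by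
        have : 0 < 14 * d ^ 2 := by positivity
        omega⟩
      rw [hm] at h1 ⊢
      simp only [Nat.add_sub_cancel]
      nlinarith)
  by_contra hx
  have h1 : 1 ≤ (remaining f J).card := Finset.card_pos.2 ⟨x, mem_remaining.2 (not_lt.1 hx)⟩
  have h2 : (remaining f 0).card ≤ Fintype.card V := Finset.card_le_univ _
  have h3 : 2 ^ l * 1 ≤ 2 ^ l * (remaining f J).card := Nat.mul_le_mul_left _ h1
  rw [← hJ] at h
  omega

lemma Agreement.mem_remaining_iff {f f' : V → ℕ} {t : ℕ} (hf : Set.EqOn f f' (Z t)) (i : ℕ) :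
    ∀ x ∈ Z t, x ∈ remaining f i ↔ x ∈ remaining f' i := fun x hx => by
  rw [mem_remaining, mem_remaining, hf hx]

lemma Agreement.peelLevel (h : Agreement G G' Z) (i : ℕ) :
    Set.EqOn (peelLevel Color d r G i) (peelLevel Color d r G' i) (Z (i * (2 * r + 1))) := by
  induction i with
  | zero => exact fun x _ => rfl
  | succ i ih =>
    intro x hx
    rw [Nat.succ_mul] at hx
    rw [_root_.peelLevel, _root_.peelLevel, ih (h.antitone (Nat.le_add_right _ _) hx)]
    simp only [h.isCluster_iff (Agreement.mem_remaining_iff ih i) hx]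

end Peeling

/-! ### Greedy extension of partial colorings -/

section Greedy
variable {V : Type*} {Color : Type*} {G G' : SimpleGraph V} {Z : ℕ → Set V}

/-- The colors of the list of `x` that no neighbor of `x` has in the partial coloring `c`. -/
def freeColors (G : SimpleGraph V) (L : V → Finset Color) (c : V → Option Color) (x : V) :
    Finset Color :=
  (L x).filter fun col => ∀ y, G.Adj x y → c y ≠ some col

lemma mem_freeColors {L : V → Finset Color} {c : V → Option Color} {x : V} {col : Color} :
    col ∈ freeColors G L c x ↔ col ∈ L x ∧ ∀ y, G.Adj x y → c y ≠ some col :=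
  Finset.mem_filter

lemma card_le_card_freeColors {L : V → Finset Color} {c : V → Option Color} {x : V}
    {N : Finset V} (h : ∀ y, G.Adj x y → c y ≠ none → y ∈ N) :
    (L x).card ≤ (freeColors G L c x).card + degIn G N x := by
  rcases (L x).eq_empty_or_nonempty with h0 | ⟨col0, -⟩
  · simp [h0]
  refine (card_le_card_sdiff_image (G := G) N (L x) (fun y => (c y).getD col0) x).trans
    (Nat.add_le_add_right (Finset.card_le_card fun col hcol => ?_) _)
  obtain ⟨h1, h2⟩ := Finset.mem_sdiff.1 hcol
  refine mem_freeColors.2 ⟨h1, fun y hy he => h2 (Finset.mem_image.2 ⟨y, ?_, by rw [he]; rfl⟩)⟩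
  exact Finset.mem_filter.2 ⟨h y hy (by rw [he]; simp), hy⟩

/-- Some element of `s`, if there is one. -/
def pickFrom {α : Type*} (s : Finset α) : Option α :=
  if h : s.Nonempty then some h.choose else none

lemma mem_of_pickFrom {α : Type*} {s : Finset α} {a : α} (h : pickFrom s = some a) : a ∈ s := by
  unfold pickFrom at h
  split_ifs at h with hs
  rw [← Option.some.inj h]
  exact hs.choose_spec

lemma pickFrom_ne_none {α : Type*} {s : Finset α} (h : s.Nonempty) : pickFrom s ≠ none := by
  simp [pickFrom, h]

/-- Extends the partial coloring `c` greedily: in step `j`, the vertices with `f x = j` choose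
a free color. -/
def greedyColoring (G : SimpleGraph V) (L : V → Finset Color) (f : V → ℕ)
    (c : V → Option Color) : ℕ → V → Option Color
  | 0 => c
  | j + 1 => fun x => if f x = j then pickFrom (freeColors G L (greedyColoring G L f c j) x)
      else greedyColoring G L f c j x

/-- `c` colors some of the vertices properly from the lists `L`. -/
def IsPartialColoring (G : SimpleGraph V) (L : V → Finset Color) (c : V → Option Color) : Prop :=
  (∀ x col, c x = some col → col ∈ L x) ∧ ∀ x y, G.Adj x y → c x ≠ none → c x ≠ c y

/-- The greedy coloring succeeds if every scheduled vertex has more colors than neighbors that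
are colored before it. -/
lemma greedyColoring_spec [Fintype V] {L : V → Finset Color} {f : V → ℕ} {c : V → Option Color}
    {k : ℕ} (hc : IsPartialColoring G L c)
    (hne : ∀ x y, G.Adj x y → f x < k → f x ≠ f y)
    (hfree : ∀ x, f x < k →
      degIn G (Finset.univ.filter fun y => c y ≠ none ∨ f y < f x) x < (L x).card) :
    IsPartialColoring G L (greedyColoring G L f c k) ∧
      ∀ x, greedyColoring G L f c k x ≠ none ↔ c x ≠ none ∨ f x < k := by
  suffices ∀ j ≤ k, IsPartialColoring G L (greedyColoring G L f c j) ∧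
      ∀ x, greedyColoring G L f c j x ≠ none ↔ c x ≠ none ∨ f x < j from this k le_rfl
  intro j
  induction j with
  | zero =>
    intro _
    refine ⟨hc, fun x => ?_⟩
    simp [greedyColoring]
  | succ j ih =>
    intro hj
    obtain ⟨⟨ih1, ih2⟩, ih3⟩ := ih (by omega)
    set g := greedyColoring G L f c j with hg
    have hstep : ∀ x, greedyColoring G L f c (j + 1) x =
        if f x = j then pickFrom (freeColors G L g x) else g x := fun x => rfl
    have hpick : ∀ x, f x = j → (freeColors G L g x).Nonempty := by
      intro x hx
      have h1 := card_le_card_freeColors (G := G) (L := L) (c := g) (x := x)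
        (N := Finset.univ.filter fun y => c y ≠ none ∨ f y < f x) fun y _ hy =>
          Finset.mem_filter.2 ⟨Finset.mem_univ _, hx ▸ (ih3 y).1 hy⟩
      exact Finset.card_pos.1 ((lt_add_iff_pos_left _).1 ((hfree x (by omega)).trans_le h1))
    have hfresh : ∀ x y, G.Adj x y → f x = j →
        pickFrom (freeColors G L g x) ≠ g y := by
      intro x y hxy hx he
      obtain ⟨col, hcol⟩ := Option.ne_none_iff_exists'.1 (pickFrom_ne_none (hpick x hx))
      exact (mem_freeColors.1 (mem_of_pickFrom hcol)).2 y hxy (by rw [← he, hcol])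
    refine ⟨⟨fun x col hx => ?_, fun x y hxy hx => ?_⟩, fun x => ?_⟩
    · rw [hstep] at hx
      split_ifs at hx with h
      · exact (mem_freeColors.1 (mem_of_pickFrom hx)).1
      · exact ih1 x col hx
    · rw [hstep] at hx
      rw [hstep, hstep]
      by_cases h : f x = j <;> by_cases h' : f y = j
      · exact absurd (h.trans h'.symm) (hne x y hxy (by omega))
      · rw [if_pos h, if_neg h']
        exact hfresh x y hxy h
      · rw [if_neg h, if_pos h']
        exact (hfresh y x hxy.symm h').symm
      · rw [if_neg h] at hx
        rw [if_neg h, if_neg h']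
        exact ih2 x y hxy hx
    · rw [hstep]
      by_cases h : f x = j
      · rw [if_pos h]
        exact iff_of_true (pickFrom_ne_none (hpick x h)) (Or.inr (by omega))
      · rw [if_neg h, ih3 x]
        exact or_congr_right ⟨fun h' => by omega, fun h' => by omega⟩

lemma Agreement.freeColors_eq {L L' : V → Finset Color} {c c' : V → Option Color} {t : ℕ}
    (h : Agreement G G' Z) (hL : Set.EqOn L L' (Z t)) (hc : Set.EqOn c c' (Z t)) :
    Set.EqOn (freeColors G L c) (freeColors G' L' c') (Z (t + 1)) := by
  intro x hx
  unfold freeColors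
  rw [hL (h.succ_subset _ hx)]
  refine Finset.filter_congr fun col _ => forall_congr' fun y => ?_
  rw [← h.adj_iff hx y]
  exact forall_congr' fun hy => by rw [hc (h.mem_of_adj hx hy)]

lemma Agreement.greedyColoring {L L' : V → Finset Color} {f f' : V → ℕ}
    {c c' : V → Option Color} {t : ℕ} (h : Agreement G G' Z) (hL : Set.EqOn L L' (Z t))
    (hf : Set.EqOn f f' (Z t)) (hc : Set.EqOn c c' (Z t)) (j : ℕ) :
    Set.EqOn (greedyColoring G L f c j) (greedyColoring G' L' f' c' j) (Z (t + j)) := by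
  induction j with
  | zero => exact hc
  | succ j ih =>
    intro x hx
    have hx' : x ∈ Z (t + j) := h.succ_subset _ hx
    have hle : Z (t + j) ⊆ Z t := h.antitone (Nat.le_add_right t j)
    change (if f x = j then _ else _) = if f' x = j then _ else _
    rw [hf (hle hx'), ih hx', h.freeColors_eq (fun y hy => hL (hle hy)) ih hx]

end Greedy

/-! ### Colorings and ruling sets by recursion on the bits of the identifiers -/

section Bits
variable {V : Type*} {G G' : SimpleGraph V} {Z : ℕ → Set V}

/-- The coloring with colors `0, …, d` of the graph of the edges between vertices whose
identifiers agree apart from their last `j` bits. It is obtained from the one for `j - 1`, which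
colors both halves of each class: the half with bit `1` is recolored greedily, color by color. -/
def bitColoring (G : SimpleGraph V) (ident : V → ℕ) (d : ℕ) : ℕ → V → Option ℕ
  | 0 => fun _ => some 0
  | j + 1 => greedyColoring (sameLevel G fun x => ident x / 2 ^ (j + 1))
      (fun _ => Finset.range (d + 1))
      (fun x => if ident x / 2 ^ j % 2 = 1 then (bitColoring G ident d j x).getD 0 else d + 1)
      (fun x => if ident x / 2 ^ j % 2 = 1 then none else bitColoring G ident d j x) (d + 1)

lemma div_two_pow_eq {a b j : ℕ} (h : a / 2 ^ (j + 1) = b / 2 ^ (j + 1))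
    (h' : a / 2 ^ j % 2 = b / 2 ^ j % 2) : a / 2 ^ j = b / 2 ^ j := by
  rw [pow_succ, ← Nat.div_div_eq_div_mul, ← Nat.div_div_eq_div_mul] at h
  omega

lemma bitColoring_spec [Fintype V] {ident : V → ℕ} (hinj : Function.Injective ident) {d : ℕ}
    (hdeg : ∀ x, degIn G Finset.univ x ≤ d) (j : ℕ) :
    IsPartialColoring (sameLevel G fun x => ident x / 2 ^ j) (fun _ => Finset.range (d + 1))
      (bitColoring G ident d j) ∧ ∀ x, bitColoring G ident d j x ≠ none := by
  induction j with
  | zero =>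
    refine ⟨⟨fun x col h => ?_, fun x y hxy => ?_⟩, fun x => by simp [bitColoring]⟩
    · simp only [bitColoring, Option.some.injEq] at h
      simp [← h]
    · have : ident x = ident y := by simpa using hxy.2
      exact absurd (hinj this) hxy.1.ne
  | succ j ih =>
    obtain ⟨⟨ih1, ih2⟩, ih3⟩ := ih
    set b := bitColoring G ident d j with hb
    set f : V → ℕ := fun x => if ident x / 2 ^ j % 2 = 1 then (b x).getD 0 else d + 1 with hf
    have hflt : ∀ x, f x < d + 1 ↔ ident x / 2 ^ j % 2 = 1 := by
      intro x
      simp only [hf]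
      split_ifs with h
      · obtain ⟨col, hcol⟩ := Option.ne_none_iff_exists'.1 (ih3 x)
        have := ih1 x col hcol
        simpa [hcol, h] using this
      · exact iff_of_false (lt_irrefl _) h
    have hc : IsPartialColoring (sameLevel G fun x => ident x / 2 ^ (j + 1))
        (fun _ => Finset.range (d + 1))
        (fun x => if ident x / 2 ^ j % 2 = 1 then none else b x) := by
      refine ⟨fun x col h => ?_, fun x y hxy hx => ?_⟩
      · simp only at h
        split_ifs at h
        exact ih1 x col h
      · by_cases h : ident x / 2 ^ j % 2 = 1
        · simp [h] at hx
        · by_cases h' : ident y / 2 ^ j % 2 = 1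
          · simp only [h, h', if_true, if_false]
            exact ih3 x
          · simp only [h, h', if_false]
            exact ih2 x y ⟨hxy.1, div_two_pow_eq hxy.2 (by omega)⟩ (ih3 x)
    have hne : ∀ x y, (sameLevel G fun x => ident x / 2 ^ (j + 1)).Adj x y → f x < d + 1 →
        f x ≠ f y := by
      intro x y hxy hx
      have hx1 := (hflt x).1 hx
      by_cases h' : ident y / 2 ^ j % 2 = 1
      · simp only [hf, hx1, h', if_true]
        have := ih2 x y ⟨hxy.1, div_two_pow_eq hxy.2 (by omega)⟩ (ih3 x)
        obtain ⟨col, hcol⟩ := Option.ne_none_iff_exists'.1 (ih3 x)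
        obtain ⟨col', hcol'⟩ := Option.ne_none_iff_exists'.1 (ih3 y)
        rw [hcol, hcol'] at this ⊢
        simpa using this
      · have : ¬ f y < d + 1 := fun h => h' ((hflt y).1 h)
        omega
    obtain ⟨h1, h2⟩ := greedyColoring_spec hc hne fun x hx => by
      rw [Finset.card_range, Nat.lt_succ_iff]
      refine le_trans (Finset.card_le_card fun y hy => ?_) (hdeg x)
      simp only [Finset.mem_filter, Finset.mem_univ, true_and] at hy ⊢
      exact hy.2.1
    refine ⟨h1, fun x => (h2 x).2 ?_⟩
    by_cases hx : ident x / 2 ^ j % 2 = 1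
    · exact Or.inr ((hflt x).2 hx)
    · refine Or.inl ?_
      rw [if_neg hx]
      exact ih3 x

lemma Agreement.bitColoring (h : Agreement G G' Z) (ident : V → ℕ) (d j : ℕ) :
    Set.EqOn (bitColoring G ident d j) (bitColoring G' ident d j) (Z (j * (d + 1))) := by
  induction j with
  | zero => exact fun _ _ => rfl
  | succ j ih =>
    rw [Nat.succ_mul]
    have h' := h.sameLevel (f := fun x => ident x / 2 ^ (j + 1)) (t := 0) fun _ _ => rfl
    simp only [zero_add] at h'
    refine h'.greedyColoring (fun _ _ => rfl) (fun x hx => ?_) (fun x hx => ?_) _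
    · simp only [ih hx]
    · simp only [ih hx]

/-- A set of vertices such that two of its vertices are at distance more than `s` if their
identifiers agree apart from their last `j` bits. In each step the elements with bit `1` that are
close to an element with bit `0` in the same class are dropped. -/
def bitRulingSet (G : SimpleGraph V) (ident : V → ℕ) (s : ℕ) : ℕ → V → Prop
  | 0, _ => True
  | j + 1, x => bitRulingSet G ident s j x ∧ (ident x / 2 ^ j % 2 = 1 →
      ∀ y, bitRulingSet G ident s j y → ident x / 2 ^ (j + 1) = ident y / 2 ^ (j + 1) →
        ident y / 2 ^ j % 2 = 0 → ¬ Within G s x y)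

lemma bitRulingSet_separated {ident : V → ℕ} (hinj : Function.Injective ident) {s j : ℕ}
    {x y : V} (hx : bitRulingSet G ident s j x) (hy : bitRulingSet G ident s j y)
    (hxy : ident x / 2 ^ j = ident y / 2 ^ j) (hw : Within G s x y) : x = y := by
  induction j with
  | zero => exact hinj (by simpa using hxy)
  | succ j ih =>
    rcases Nat.mod_two_eq_zero_or_one (ident x / 2 ^ j) with h | h <;>
      rcases Nat.mod_two_eq_zero_or_one (ident y / 2 ^ j) with h' | h'
    · exact ih hx.1 hy.1 (div_two_pow_eq hxy (by omega))
    · exact absurd hw.symm (hy.2 h' x hx.1 hxy.symm h)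
    · exact absurd hw (hx.2 h y hy.1 hxy h')
    · exact ih hx.1 hy.1 (div_two_pow_eq hxy (by omega))

lemma exists_bitRulingSet_within (ident : V → ℕ) (s j : ℕ) (x : V) :
    ∃ y, bitRulingSet G ident s j y ∧ ident x / 2 ^ j = ident y / 2 ^ j ∧
      Within G (j * s) x y := by
  induction j with
  | zero => exact ⟨x, trivial, rfl, Within.refl _ _⟩
  | succ j ih =>
    obtain ⟨y, hy, hxy, hw⟩ := ih
    have hcl : ident x / 2 ^ (j + 1) = ident y / 2 ^ (j + 1) := by
      rw [pow_succ, ← Nat.div_div_eq_div_mul, ← Nat.div_div_eq_div_mul, hxy]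
    by_cases hy' : bitRulingSet G ident s (j + 1) y
    · exact ⟨y, hy', hcl, hw.mono (Nat.mul_le_mul_right _ (Nat.le_succ j))⟩
    · simp only [bitRulingSet, not_and, Classical.not_imp, not_forall, not_not] at hy'
      obtain ⟨-, z, hz, hyz, hz0, hw'⟩ := hy' hy
      refine ⟨z, ⟨hz, fun h => by omega⟩, hcl.trans hyz, ?_⟩
      rw [Nat.succ_mul]
      exact hw.trans hw'

lemma Agreement.bitRulingSet (h : Agreement G G' Z) (ident : V → ℕ) (s j : ℕ) :
    Set.EqOn (bitRulingSet G ident s j) (bitRulingSet G' ident s j) (Z (j * s)) := by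
  induction j with
  | zero => exact fun _ _ => rfl
  | succ j ih =>
    intro x hx
    rw [Nat.succ_mul] at hx
    have hx' : x ∈ Z s := h.antitone (Nat.le_add_left _ _) hx
    simp only [_root_.bitRulingSet, eq_iff_iff]
    rw [ih (h.antitone (Nat.le_add_right _ _) hx)]
    refine and_congr_right fun _ => forall_congr' fun _ => forall_congr' fun y => ?_
    rw [← h.within_iff hx' y]
    by_cases hw : Within G s x y
    · rw [ih (h.mem_of_within hx hw)]
    · simp [hw]

end Bits

/-! ### Coloring along a schedule -/

section Schedules
variable {V : Type*} {Color : Type*} {G G' : SimpleGraph V} {Z : ℕ → Set V}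

/-- The data that organize the coloring. The levels are colored in decreasing order. Within a level,
the vertices outside the clusters of the roots are colored in the order of their ranks, and then
all these clusters are colored. -/
structure Schedule (V : Type*) where
  /-- the level of a vertex -/
  level : V → ℕ
  /-- the vertices whose clusters are used -/
  root : V → Prop
  /-- the cluster of a root -/
  cluster : V → Finset V
  /-- the order in which the vertices of a level are colored -/
  rank : V → ℕ

namespace Schedule

/-- `x` lies in the cluster of a root. -/
def Clustered (S : Schedule V) (x : V) : Prop := ∃ q, S.root q ∧ x ∈ S.cluster q

/-- The conditions under which coloring along the schedule with lists of size `d` succeeds, for `I`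
levels and ranks less than `K`. -/
structure IsValid [Fintype V] (S : Schedule V) (Color : Type*) (d I K : ℕ)
    (G : SimpleGraph V) : Prop where
  level_lt : ∀ x, S.level x < I
  degIn_le : ∀ x, degIn G (remaining S.level (S.level x)) x ≤ d
  level_eq : ∀ {q x}, S.root q → x ∈ S.cluster q → S.level x = S.level q
  colorableLast : ∀ {q}, S.root q →
    ColorableLast Color d G (remaining S.level (S.level q)) (S.cluster q)
  separated : ∀ {q q' x y}, S.root q → S.root q' → x ∈ S.cluster q → y ∈ S.cluster q' →
    S.level x = S.level y → x = y ∨ G.Adj x y → q = q'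
  rank_lt : ∀ x, S.rank x < K
  rank_ne : ∀ {x y}, G.Adj x y → S.level x = S.level y → S.rank x ≠ S.rank y
  exists_later : ∀ {x}, ¬ S.Clustered x →
    ∃ y, G.Adj x y ∧ S.level x = S.level y ∧ (S.Clustered y ∨ S.rank x < S.rank y)

/-- The greedy step in which a vertex is colored while level `i` is treated; it is `K`, beyond
the last step, for the vertices that are not to be colored greedily. -/
def time (S : Schedule V) (K i : ℕ) (x : V) : ℕ :=
  if S.level x = i ∧ ¬ S.Clustered x then S.rank x else K

/-- A proper coloring of `U` from the colors that are free with respect to the partial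
coloring `c`, if there is one. -/
def _root_.clusterColoring (G : SimpleGraph V) (L : V → Finset Color) (c : V → Option Color)
    (U : Finset V) : V → Option Color :=
  Classical.epsilon fun e => (∀ x ∈ U, ∃ col ∈ freeColors G L c x, e x = some col) ∧
    ∀ x ∈ U, ∀ y ∈ U, G.Adj x y → e x ≠ e y

/-- Extends the partial coloring `c` to the vertices of level `i`. -/
def colorLevel (S : Schedule V) (G : SimpleGraph V) (L : V → Finset Color) (K i : ℕ)
    (c : V → Option Color) (x : V) : Option Color :=
  if S.level x = i ∧ S.Clustered x then
    clusterColoring G L (greedyColoring G L (S.time K i) c K)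
      (S.cluster (@Classical.epsilon V ⟨x⟩ fun q => S.root q ∧ x ∈ S.cluster q)) x
  else greedyColoring G L (S.time K i) c K x

/-- The partial coloring after the top `j` of the levels `0, …, I - 1` have been treated. -/
def coloring (S : Schedule V) (G : SimpleGraph V) (L : V → Finset Color) (I K : ℕ) :
    ℕ → V → Option Color
  | 0 => fun _ => none
  | j + 1 => S.colorLevel G L K (I - 1 - j) (S.coloring G L I K j)

section Correctness
variable [Fintype V] {S : Schedule V} {d I K : ℕ} {L : V → Finset Color}

lemma IsValid.greedyColoring_spec (hS : S.IsValid Color d I K G) (hL : ∀ x, d ≤ (L x).card)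
    {i : ℕ} {c : V → Option Color} (hc : IsPartialColoring G L c)
    (hdom : ∀ x, c x ≠ none ↔ i < S.level x) :
    IsPartialColoring G L (greedyColoring G L (S.time K i) c K) ∧
      ∀ x, greedyColoring G L (S.time K i) c K x ≠ none ↔
        i < S.level x ∨ S.level x = i ∧ ¬ S.Clustered x := by
  have htime : ∀ x, S.time K i x < K ↔ S.level x = i ∧ ¬ S.Clustered x := by
    intro x
    unfold time
    split_ifs with h
    · exact iff_of_true (hS.rank_lt x) h
    · exact iff_of_false (lt_irrefl _) h
  have htime' : ∀ x, S.time K i x < K → S.time K i x = S.rank x := fun x hx =>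
    if_pos ((htime x).1 hx)
  have hne : ∀ x y, G.Adj x y → S.time K i x < K → S.time K i x ≠ S.time K i y := by
    intro x y hxy hx he
    have hy : S.time K i y < K := he ▸ hx
    rw [htime' x hx, htime' y hy] at he
    exact hS.rank_ne hxy (((htime x).1 hx).1.trans ((htime y).1 hy).1.symm) he
  have hfree : ∀ x, S.time K i x < K → degIn G (Finset.univ.filter fun y =>
      c y ≠ none ∨ S.time K i y < S.time K i x) x < (L x).card := by
    intro x hx
    obtain ⟨hxi, hxc⟩ := (htime x).1 hx
    obtain ⟨y, hxy, hlev, hy⟩ := hS.exists_later hxc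
    have hd := hS.degIn_le x
    rw [hxi] at hd
    refine (lt_of_lt_of_le (Finset.card_lt_card ⟨fun w hw => ?_, fun h => ?_⟩) hd).trans_le (hL x)
    · obtain ⟨hw, hxw⟩ := Finset.mem_filter.1 hw
      refine Finset.mem_filter.2 ⟨mem_remaining.2 ?_, hxw⟩
      rcases (Finset.mem_filter.1 hw).2 with hw | hw
      · exact ((hdom w).1 hw).le
      · exact ((htime w).1 (hw.trans hx)).1.ge
    · have hy' := (Finset.mem_filter.1 (h (Finset.mem_filter.2
        ⟨mem_remaining.2 (by omega), hxy⟩))).1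
      rcases (Finset.mem_filter.1 hy').2 with hw | hw
      · have := (hdom y).1 hw
        omega
      · have hyK := hw.trans hx
        rw [htime' x hx, htime' y hyK] at hw
        rcases hy with hy | hy
        · exact ((htime y).1 hyK).2 hy
        · omega
  obtain ⟨h1, h2⟩ := _root_.greedyColoring_spec hc hne hfree
  exact ⟨h1, fun x => by rw [h2, hdom, htime]⟩

lemma IsValid.colorLevel_spec (hS : S.IsValid Color d I K G) (hL : ∀ x, d ≤ (L x).card)
    {i : ℕ} {c : V → Option Color} (hc : IsPartialColoring G L c)
    (hdom : ∀ x, c x ≠ none ↔ i < S.level x) :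
    IsPartialColoring G L (S.colorLevel G L K i c) ∧
      ∀ x, S.colorLevel G L K i c x ≠ none ↔ i ≤ S.level x := by
  obtain ⟨⟨hg1, hg2⟩, hgdom⟩ := hS.greedyColoring_spec hL hc hdom
  have hcl : ∀ x, S.colorLevel G L K i c x = if S.level x = i ∧ S.Clustered x then
    clusterColoring G L (greedyColoring G L (S.time K i) c K)
      (S.cluster (@Classical.epsilon V ⟨x⟩ fun q => S.root q ∧ x ∈ S.cluster q)) x
    else greedyColoring G L (S.time K i) c K x := fun _ => rfl
  set g := greedyColoring G L (S.time K i) c K with hg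
  have hext : ∀ q, S.root q → S.level q = i →
      (∀ x ∈ S.cluster q, ∃ col ∈ freeColors G L g x,
        clusterColoring G L g (S.cluster q) x = some col) ∧
      ∀ x ∈ S.cluster q, ∀ y ∈ S.cluster q, G.Adj x y →
        clusterColoring G L g (S.cluster q) x ≠ clusterColoring G L g (S.cluster q) y := by
    intro q hq hqi
    refine Classical.epsilon_spec (p := fun e : V → Option Color =>
      (∀ x ∈ S.cluster q, ∃ col ∈ freeColors G L g x, e x = some col) ∧
        ∀ x ∈ S.cluster q, ∀ y ∈ S.cluster q, G.Adj x y → e x ≠ e y) ?_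
    obtain ⟨e, he, he'⟩ := hS.colorableLast hq (freeColors G L g) fun x hx => by
      refine (hL x).trans (card_le_card_freeColors fun y _ hy => Finset.mem_sdiff.2 ⟨?_, ?_⟩)
      · rw [mem_remaining, hqi]
        rcases (hgdom y).1 hy with h | h
        · exact h.le
        · exact h.1.ge
      · intro hyq
        have := hS.level_eq hq hyq
        rcases (hgdom y).1 hy with h | h
        · omega
        · exact h.2 ⟨q, hq, hyq⟩
    exact ⟨fun x => some (e x), fun x hx => ⟨e x, he x hx, rfl⟩,
      fun x hx y hy hxy h => he' x hx y hy hxy (Option.some.inj h)⟩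
  -- the values on the clusters of level `i`
  have hval : ∀ x, S.level x = i → S.Clustered x → ∃ q, S.root q ∧ x ∈ S.cluster q ∧
      S.level q = i ∧ S.colorLevel G L K i c x = clusterColoring G L g (S.cluster q) x := by
    intro x hx hxc
    obtain ⟨h1, h2⟩ := @Classical.epsilon_spec_aux V ⟨x⟩ (fun q => S.root q ∧ x ∈ S.cluster q) hxc
    exact ⟨_, h1, h2, (hS.level_eq h1 h2).symm.trans hx, by rw [hcl, if_pos ⟨hx, hxc⟩]⟩
  have hcross : ∀ x y, G.Adj x y → S.level x = i → S.Clustered x →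
      S.colorLevel G L K i c x ≠ g y := by
    intro x y hxy hx hxc
    obtain ⟨q, hq, hxq, hqi, he⟩ := hval x hx hxc
    obtain ⟨col, hcol, he'⟩ := (hext q hq hqi).1 x hxq
    rw [he, he']
    exact ((mem_freeColors.1 hcol).2 y hxy).symm
  refine ⟨⟨fun x col hx => ?_, fun x y hxy hx => ?_⟩, fun x => ?_⟩
  · by_cases h : S.level x = i ∧ S.Clustered x
    · obtain ⟨q, hq, hxq, hqi, he⟩ := hval x h.1 h.2
      obtain ⟨col', hcol', he'⟩ := (hext q hq hqi).1 x hxq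
      rw [he, he'] at hx
      rw [← Option.some.inj hx]
      exact (mem_freeColors.1 hcol').1
    · rw [hcl, if_neg h] at hx
      exact hg1 x col hx
  · by_cases h : S.level x = i ∧ S.Clustered x <;> by_cases h' : S.level y = i ∧ S.Clustered y
    · obtain ⟨q, hq, hxq, hqi, he⟩ := hval x h.1 h.2
      obtain ⟨q', hq', hyq', hqi', he'⟩ := hval y h'.1 h'.2
      obtain rfl := hS.separated hq hq' hxq hyq' (h.1.trans h'.1.symm) (Or.inr hxy)
      rw [he, he']
      exact (hext q hq hqi).2 x hxq y hyq' hxy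
    · have h2 := hcross x y hxy h.1 h.2
      rwa [hcl y, if_neg h']
    · have h2 := hcross y x hxy.symm h'.1 h'.2
      rw [hcl x, if_neg h]
      exact h2.symm
    · rw [hcl, if_neg h] at hx
      rw [hcl, hcl, if_neg h, if_neg h']
      exact hg2 x y hxy hx
  · by_cases h : S.level x = i ∧ S.Clustered x
    · obtain ⟨q, hq, hxq, hqi, he⟩ := hval x h.1 h.2
      obtain ⟨col', hcol', he'⟩ := (hext q hq hqi).1 x hxq
      rw [he, he']
      exact iff_of_true (by simp) h.1.ge
    · rw [hcl, if_neg h, hgdom]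
      constructor
      · rintro (h' | h')
        · exact h'.le
        · exact h'.1.ge
      · intro h'
        rcases h'.lt_or_eq with h' | h'
        · exact Or.inl h'
        · exact Or.inr ⟨h'.symm, fun h2 => h ⟨h'.symm, h2⟩⟩

lemma IsValid.coloring_spec (hS : S.IsValid Color d I K G) (hL : ∀ x, d ≤ (L x).card) :
    IsPartialColoring G L (S.coloring G L I K I) ∧ ∀ x, S.coloring G L I K I x ≠ none := by
  have key : ∀ j ≤ I, IsPartialColoring G L (S.coloring G L I K j) ∧
      ∀ x, S.coloring G L I K j x ≠ none ↔ I ≤ S.level x + j := by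
    intro j
    induction j with
    | zero =>
      intro _
      refine ⟨⟨by simp [coloring], by simp [coloring]⟩, fun x => ?_⟩
      have := hS.level_lt x
      exact iff_of_false (by simp [coloring]) (by omega)
    | succ j ih =>
      intro hj
      obtain ⟨h1, h2⟩ := ih (by omega)
      obtain ⟨h3, h4⟩ := hS.colorLevel_spec hL (i := I - 1 - j) h1 fun x => by
        rw [h2]
        omega
      refine ⟨h3, fun x => (h4 x).trans ?_⟩
      omega
  obtain ⟨h1, h2⟩ := key I le_rfl
  exact ⟨h1, fun x => (h2 x).2 (Nat.le_add_left _ _)⟩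

end Correctness

/-- The schedules `S` and `S'` agree on the set `s`. -/
structure EqOn (S S' : Schedule V) (s : Set V) : Prop where
  level : Set.EqOn S.level S'.level s
  root : Set.EqOn S.root S'.root s
  cluster : Set.EqOn S.cluster S'.cluster s
  rank : Set.EqOn S.rank S'.rank s

/-- Every vertex of the cluster of `q` is within distance `k` of `q`. -/
def ClusterWithin (S : Schedule V) (G : SimpleGraph V) (k : ℕ) : Prop :=
  ∀ q, ∀ x ∈ S.cluster q, Within G k q x

end Schedule

namespace Agreement
open Schedule
variable {S S' : Schedule V} {k t : ℕ}

lemma clustered_imp (h : Agreement G G' Z) (hroot : Set.EqOn S.root S'.root (Z t))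
    (hcl : Set.EqOn S.cluster S'.cluster (Z t)) (hk : S.ClusterWithin G k) {x : V}
    (hx : x ∈ Z (t + k)) {q : V} (hq : S.root q ∧ x ∈ S.cluster q) :
    S'.root q ∧ x ∈ S'.cluster q := by
  have hqZ : q ∈ Z t := h.mem_of_within hx (hk q x hq.2).symm
  rwa [hroot hqZ, hcl hqZ] at hq

lemma root_and_mem_iff (h : Agreement G G' Z) (hroot : Set.EqOn S.root S'.root (Z t))
    (hcl : Set.EqOn S.cluster S'.cluster (Z t)) (hk : S.ClusterWithin G k)
    (hk' : S'.ClusterWithin G' k) {x : V} (hx : x ∈ Z (t + k)) (q : V) :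
    (S.root q ∧ x ∈ S.cluster q) ↔ (S'.root q ∧ x ∈ S'.cluster q) :=
  ⟨h.clustered_imp hroot hcl hk hx, h.symm.clustered_imp hroot.symm hcl.symm hk' hx⟩

lemma clustered_eqOn (h : Agreement G G' Z) (hroot : Set.EqOn S.root S'.root (Z t))
    (hcl : Set.EqOn S.cluster S'.cluster (Z t)) (hk : S.ClusterWithin G k)
    (hk' : S'.ClusterWithin G' k) : Set.EqOn S.Clustered S'.Clustered (Z (t + k)) :=
  fun _ hx => propext (exists_congr (h.root_and_mem_iff hroot hcl hk hk' hx))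

lemma clusterColoring_eq (h : Agreement G G' Z) {L L' : V → Finset Color}
    (hL : Set.EqOn L L' (Z t)) {c c' : V → Option Color} (hc : Set.EqOn c c' (Z t))
    {U : Finset V} (hU : ∀ x ∈ U, x ∈ Z (t + 1)) :
    clusterColoring G L c U = clusterColoring G' L' c' U := by
  unfold clusterColoring
  congr 1
  funext e
  refine propext (and_congr (forall_congr' fun x => forall_congr' fun hx => ?_)
    (forall_congr' fun x => forall_congr' fun hx => forall_congr' fun y =>
      forall_congr' fun _ => ?_))
  · rw [h.freeColors_eq hL hc (hU x hx)]
  · rw [h.adj_iff (hU x hx)]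

lemma colorLevel (h : Agreement G G' Z) {L L' : V → Finset Color} (hL : Set.EqOn L L' (Z t))
    {K i : ℕ} {c c' : V → Option Color} (hS : S.EqOn S' (Z t)) (hk : S.ClusterWithin G k)
    (hk' : S'.ClusterWithin G' k) {s : ℕ} (hts : t + k ≤ s) (hc : Set.EqOn c c' (Z s)) :
    Set.EqOn (S.colorLevel G L K i c) (S'.colorLevel G' L' K i c')
      (Z (s + (K + 1 + 2 * k))) := by
  have hsub : ∀ {a b : ℕ}, a ≤ b → Z b ⊆ Z a := fun hab => h.antitone hab
  have hcl := h.clustered_eqOn hS.root hS.cluster hk hk'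
  have htime : Set.EqOn (S.time K i) (S'.time K i) (Z s) := fun x hx => by
    unfold time
    rw [hS.level (hsub (by omega) hx), hS.rank (hsub (by omega) hx), hcl (hsub (by omega) hx)]
  have hLs : Set.EqOn L L' (Z s) := hL.mono (hsub (by omega))
  have hg := h.greedyColoring hLs htime hc K
  intro x hx
  unfold Schedule.colorLevel
  have hx1 : x ∈ Z (t + k) := hsub (by omega) hx
  rw [hS.level (hsub (by omega) hx1), hcl hx1, hg (hsub (by omega) hx)]
  split_ifs with hxc
  · have heq : (fun q => S.root q ∧ x ∈ S.cluster q) = fun q => S'.root q ∧ x ∈ S'.cluster q :=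
      funext fun q => propext (h.root_and_mem_iff hS.root hS.cluster hk hk' hx1 q)
    have hq := @Classical.epsilon_spec_aux V ⟨x⟩ (fun q => S'.root q ∧ x ∈ S'.cluster q) hxc.2
    rw [heq]
    set q := @Classical.epsilon V ⟨x⟩ fun q => S'.root q ∧ x ∈ S'.cluster q with hqdef
    have hq' := (h.root_and_mem_iff hS.root hS.cluster hk hk' hx1 q).2 hq
    have hqZ : q ∈ Z (s + K + 1 + k) :=
      h.mem_of_within (s := k) (hsub (by omega) hx) (hk q x hq'.2).symm
    rw [← hS.cluster (hsub (by omega) hqZ)]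
    exact congrFun (h.clusterColoring_eq (hLs.mono (hsub (Nat.le_add_right s K))) hg
      fun y hy => h.mem_of_within hqZ (hk q y hy)) x
  · rfl

lemma coloring (h : Agreement G G' Z) {L L' : V → Finset Color} (hL : Set.EqOn L L' (Z t))
    (I K : ℕ) (hS : S.EqOn S' (Z t)) (hk : S.ClusterWithin G k)
    (hk' : S'.ClusterWithin G' k) (j : ℕ) :
    Set.EqOn (S.coloring G L I K j) (S'.coloring G' L' I K j)
      (Z (t + k + j * (K + 1 + 2 * k))) := by
  induction j with
  | zero => exact fun _ _ => rfl
  | succ j ih =>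
    rw [Nat.succ_mul, ← add_assoc]
    exact h.colorLevel hL hS hk hk' (Nat.le_add_right _ _) ih

end Agreement
end Schedules

/-! ### The schedule from the removal of the clusters -/

section PeelingSchedule
variable {V : Type*} [Fintype V] {Color : Type*} {G G' : SimpleGraph V} {Z : ℕ → Set V}

/-- Some set with the property `P`, or the empty set if there is none. -/
def pickSet (P : Finset V → Prop) : Finset V := if h : ∃ U, P U then h.choose else ∅

lemma pickSet_spec {P : Finset V → Prop} (h : ∃ U, P U) : P (pickSet P) := by
  rw [pickSet, dif_pos h]
  exact h.choose_spec

lemma of_mem_pickSet {P : Finset V → Prop} {x : V} (h : x ∈ pickSet P) : P (pickSet P) := by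
  refine pickSet_spec ?_
  by_contra hno
  rw [pickSet, dif_neg hno] at h
  exact absurd h (Finset.notMem_empty x)

/-- The distance of `x` in `H` from the vertices with the property `P`, but at most `m`. -/
def truncDist (H : SimpleGraph V) (P : V → Prop) (m : ℕ) (x : V) : ℕ :=
  ((Finset.range m).filter fun k => ¬ ∃ y, P y ∧ Within H k x y).card

lemma truncDist_le (H : SimpleGraph V) (P : V → Prop) (m : ℕ) (x : V) : truncDist H P m x ≤ m :=
  (Finset.card_filter_le _ _).trans (Finset.card_range m).le

lemma exists_adj_truncDist_lt {H : SimpleGraph V} {P : V → Prop} {m : ℕ} {x : V} (hx : ¬ P x)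
    (h : ∃ y, P y ∧ Within H m x y) : ∃ y, H.Adj x y ∧ truncDist H P m y < truncDist H P m x := by
  have hex : ∃ k, ∃ y, P y ∧ Within H k x y := ⟨m, h⟩
  obtain ⟨y, hy, hw⟩ := Nat.find_spec hex
  have hle : Nat.find hex ≤ m := Nat.find_min' hex h
  have hmin := fun k => Nat.find_min (H := hex) (m := k)
  generalize Nat.find hex = k at hw hle hmin
  cases k with
  | zero => exact absurd (within_zero.1 hw ▸ hy) hx
  | succ k =>
    rcases within_succ.1 hw with rfl | ⟨z, hxz, hw'⟩
    · exact absurd hy hx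
    refine ⟨z, hxz, ?_⟩
    calc truncDist H P m z ≤ (Finset.range k).card := by
          refine Finset.card_le_card fun j hj => ?_
          obtain ⟨-, hj⟩ := Finset.mem_filter.1 hj
          rw [Finset.mem_range]
          by_contra hkj
          exact hj ⟨y, hy, hw'.mono (not_lt.1 hkj)⟩
      _ < (Finset.range (k + 1)).card := by simp
      _ ≤ truncDist H P m x := by
          refine Finset.card_le_card fun j hj => Finset.mem_filter.2 ⟨?_, ?_⟩
          · rw [Finset.mem_range] at *
            omega
          · exact hmin j (Finset.mem_range.1 hj)

lemma Agreement.truncDist {P P' : V → Prop} {t : ℕ} (h : Agreement G G' Z)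
    (hP : Set.EqOn P P' (Z t)) (m : ℕ) :
    Set.EqOn (truncDist G P m) (truncDist G' P' m) (Z (t + m)) := by
  intro x hx
  unfold _root_.truncDist
  congr 1
  refine Finset.filter_congr fun k hk => not_congr (exists_congr fun y => ?_)
  rw [Finset.mem_range] at hk
  rw [← h.within_iff (h.antitone (by omega) hx) y]
  by_cases hw : Within G k x y
  · rw [hP (h.mem_of_within (h.antitone (by omega) hx) hw)]
  · simp [hw]

/-- The schedule used for the coloring. The levels come from the removal of clusters of radius `r`.
The roots form a ruling set of the graph inside the levels, sparse enough to keep the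
clusters of different roots apart. The vertices of a level that are far from the clusters are
colored first, and ties are broken by a proper coloring with `d + 1` colors. -/
def peelingSchedule (Color : Type*) (d r I l : ℕ) (ident : V → ℕ) (G : SimpleGraph V) :
    Schedule V :=
  let f := peelLevel Color d r G I
  let H := sameLevel G f
  let root := bitRulingSet H ident (4 * r + 1) l
  let cluster := fun q => pickSet fun U => q ∈ U ∧ IsCluster Color d r G (remaining f (f q)) U
  let m := l * (4 * r + 1)
  { level := f
    root := root
    cluster := cluster
    rank := fun x => (m - truncDist H (fun x => ∃ q, root q ∧ x ∈ cluster q) m x) * (d + 1) +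
      (bitColoring H ident d l x).getD 0 }

variable {d r I l : ℕ} {ident : V → ℕ}

lemma isCluster_of_mem_peelingSchedule {q x : V}
    (h : x ∈ (peelingSchedule Color d r I l ident G).cluster q) :
    q ∈ (peelingSchedule Color d r I l ident G).cluster q ∧
      IsCluster Color d r G (remaining (peelLevel Color d r G I) (peelLevel Color d r G I q))
        ((peelingSchedule Color d r I l ident G).cluster q) :=
  of_mem_pickSet (P := fun U => q ∈ U ∧ IsCluster Color d r G
    (remaining (peelLevel Color d r G I) (peelLevel Color d r G I q)) U) h

lemma clusterWithin_peelingSchedule :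
    (peelingSchedule Color d r I l ident G).ClusterWithin G (2 * r) := fun _ _ hx =>
  ((isCluster_of_mem_peelingSchedule hx).2.within
    (isCluster_of_mem_peelingSchedule hx).1 hx).mono_graph (restrictTo_le _)

/-- The number of rounds in which the schedule is computed. -/
def scheduleRounds (d r I l : ℕ) : ℕ :=
  I * (2 * r + 1) + l * (4 * r + 1) + l * (d + 1) + (2 * r + 1) + 2 * r + l * (4 * r + 1)

lemma Agreement.peelingSchedule (h : Agreement G G' Z) :
    (peelingSchedule Color d r I l ident G).EqOn (peelingSchedule Color d r I l ident G')
      (Z (scheduleRounds d r I l)) := by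
  have hsub : ∀ {a b : ℕ}, a ≤ b → Z b ⊆ Z a := fun hab => h.antitone hab
  have hf := h.peelLevel (Color := Color) (d := d) (r := r) I
  have hH := h.sameLevel hf
  have hroot := hH.bitRulingSet ident (4 * r + 1) l
  have hcol := hH.bitColoring ident d l
  have hclu : Set.EqOn (_root_.peelingSchedule Color d r I l ident G).cluster
      (_root_.peelingSchedule Color d r I l ident G').cluster
      (Z (I * (2 * r + 1) + (2 * r + 1))) := by
    intro q hq
    refine congrArg pickSet (funext fun U => propext ?_)
    rw [hf (hsub (Nat.le_add_right _ _) hq)]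
    exact h.isCluster_iff (Agreement.mem_remaining_iff hf _) hq U
  set t := I * (2 * r + 1) + l * (4 * r + 1) + l * (d + 1) + (2 * r + 1) with ht
  have hroot' : Set.EqOn (_root_.peelingSchedule Color d r I l ident G).root
      (_root_.peelingSchedule Color d r I l ident G').root (Z t) :=
    hroot.mono (hsub (by omega))
  have hclu' := hclu.mono (hsub (show _ ≤ t by omega))
  have hP := h.clustered_eqOn hroot' hclu' clusterWithin_peelingSchedule
    clusterWithin_peelingSchedule
  have hH' := h.sameLevel (t := t + 2 * r) (hf.mono (hsub (by omega)))
  have hdist := hH'.truncDist (t := 0) hP (l * (4 * r + 1))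
  have hT : scheduleRounds d r I l = t + 2 * r + (0 + l * (4 * r + 1)) := by
    rw [scheduleRounds, zero_add]
  refine ⟨hf.mono (hsub (by omega)), hroot'.mono (hsub (by omega)), hclu'.mono (hsub (by omega)),
    fun x hx => ?_⟩
  rw [hT] at hx
  have h1 := hdist hx
  have h2 := hcol (hsub (show _ ≤ _ by omega) hx)
  exact congrArg₂ (fun a b : ℕ => (l * (4 * r + 1) - a) * (d + 1) + b) h1
    (congrArg (Option.getD · 0) h2)

/-- With `O(d log n)` as the radius of the clusters and `O(d ^ 2 log n)` levels, the schedule is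
valid. -/
lemma isValid_peelingSchedule [Nonempty Color] (hd : 4 ≤ d) (hsp : DegreeSparse d G)
    (hcard : Fintype.card V < 2 ^ l) (hinj : Function.Injective ident)
    (hident : ∀ x, ident x < 2 ^ l) :
    (peelingSchedule Color d (16 * d * l) (14 * d ^ 2 * l) l ident G).IsValid Color d
      (14 * d ^ 2 * l) ((l * (4 * (16 * d * l) + 1) + 1) * (d + 1)) G := by
  set r := 16 * d * l with hr
  set I := 14 * d ^ 2 * l with hI
  set S := peelingSchedule Color d r I l ident G with hS
  set f := peelLevel Color d r G I with hf
  set m := l * (4 * r + 1) with hm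
  have hSlevel : S.level = f := rfl
  have hlt : ∀ x, f x < I := peelLevel_lt hd hsp hcard
  have hmem : ∀ x, x ∈ clustered Color d r G (remaining f (f x)) := fun x =>
    mem_clustered_of_peelLevel_eq (hlt x) rfl
  have hcluster : ∀ q, q ∈ S.cluster q ∧ IsCluster Color d r G (remaining f (f q)) (S.cluster q) :=
    fun q => pickSet_spec (P := fun U => q ∈ U ∧ IsCluster Color d r G (remaining f (f q)) U)
      (mem_clustered.1 (hmem q)).2
  have hlevel : ∀ {q x}, x ∈ S.cluster q → f x = f q := fun {q x} hx =>
    peelLevel_eq_of_mem_clustered (hlt q) (mem_clustered.2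
      ⟨(hcluster q).2.subset hx, _, hx, (hcluster q).2⟩)
  have hdeg : ∀ x, degIn G (remaining f (f x)) x ≤ d := fun x => by
    obtain ⟨-, U, hxU, hU⟩ := mem_clustered.1 (hmem x)
    exact hU.degIn_le x hxU
  set H := sameLevel G f with hH
  have hHdeg : ∀ x, degIn H Finset.univ x ≤ d := fun x => by
    refine le_trans (Finset.card_le_card fun y hy => ?_) (hdeg x)
    have hxy : G.Adj x y ∧ f x = f y := (Finset.mem_filter.1 hy).2
    exact Finset.mem_filter.2 ⟨mem_remaining.2 hxy.2.le, hxy.1⟩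
  have hzero : ∀ x, ident x / 2 ^ l = 0 := fun x => Nat.div_eq_of_lt (hident x)
  -- the clusters lie inside one level, so they are as narrow in `H` as in `G`
  have hHw : ∀ {q x}, x ∈ S.cluster q → Within H (2 * r) q x := fun {q x} hx =>
    ((hcluster q).2.within (hcluster q).1 hx).mono_graph
      (show restrictTo G (S.cluster q) ≤ sameLevel G f from fun y z hyz =>
        ⟨hyz.1, (hlevel hyz.2.1).trans (hlevel hyz.2.2).symm⟩)
  have hcol : IsPartialColoring H (fun _ => Finset.range (d + 1)) (bitColoring H ident d l) ∧
      ∀ x, bitColoring H ident d l x ≠ none := by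
    have := bitColoring_spec (G := H) hinj hHdeg l
    have hHl : (sameLevel H fun x => ident x / 2 ^ l) = H := by
      ext x y
      exact and_iff_left ((hzero x).trans (hzero y).symm)
    rwa [hHl] at this
  set κ : V → ℕ := fun x => (bitColoring H ident d l x).getD 0 with hκ
  have hκd : ∀ x, κ x ≤ d := fun x => by
    obtain ⟨c, hc⟩ := Option.ne_none_iff_exists'.1 (hcol.2 x)
    have := hcol.1.1 x c hc
    simp only [hκ, hc, Option.getD_some]
    simpa [Nat.lt_succ_iff] using this
  have hrank : ∀ x, S.rank x = (m - truncDist H S.Clustered m x) * (d + 1) + κ x := fun x => rfl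
  refine ⟨hlt, hdeg, fun _ => hlevel, fun {q} _ => (hcluster q).2.colorableLast, ?_, fun x => ?_,
    ?_, ?_⟩
  · intro q q' x y hq hq' hx hy hxy hadj
    refine bitRulingSet_separated hinj hq hq' ((hzero q).trans (hzero q').symm) ?_
    have h1 : Within H 1 x y := by
      rcases hadj with rfl | hadj
      · exact Within.refl _ _
      · exact within_of_adj ⟨hadj, hxy⟩
    exact (((hHw hx).trans h1).trans (hHw hy).symm).mono (by omega)
  · rw [hrank]
    have h1 := hκd x
    have h2 : (m - truncDist H S.Clustered m x) * (d + 1) ≤ m * (d + 1) :=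
      Nat.mul_le_mul_right _ (Nat.sub_le _ _)
    rw [Nat.succ_mul]
    omega
  · intro x y hxy hlev he
    rw [hrank, hrank] at he
    have h1 : κ x = κ y := by
      have := congrArg (· % (d + 1)) he
      simpa [Nat.add_mod, Nat.mod_eq_of_lt (Nat.lt_succ_of_le (hκd x)),
        Nat.mod_eq_of_lt (Nat.lt_succ_of_le (hκd y))] using this
    have h2 := hcol.1.2 x y ⟨hxy, hlev⟩ (hcol.2 x)
    obtain ⟨c, hc⟩ := Option.ne_none_iff_exists'.1 (hcol.2 x)
    obtain ⟨c', hc'⟩ := Option.ne_none_iff_exists'.1 (hcol.2 y)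
    simp only [hκ, hc, hc', Option.getD_some] at h1
    exact h2 (by rw [hc, hc', h1])
  · intro x hx
    obtain ⟨q, hq, -, hw⟩ := exists_bitRulingSet_within (G := H) ident (4 * r + 1) l x
    obtain ⟨y, hxy, hlt⟩ : ∃ y, H.Adj x y ∧
        truncDist H S.Clustered m y < truncDist H S.Clustered m x :=
      exists_adj_truncDist_lt hx ⟨q, ⟨q, hq, (hcluster q).1⟩, hw⟩
    refine ⟨y, hxy.1, hxy.2, Or.inr ?_⟩
    rw [hrank, hrank]
    have h1 := hκd x
    have h2 := truncDist_le H S.Clustered m x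
    have h3 : (m - truncDist H S.Clustered m x + 1) * (d + 1) ≤
        (m - truncDist H S.Clustered m y) * (d + 1) := Nat.mul_le_mul_right _ (by omega)
    rw [Nat.succ_mul] at h3
    omega

end PeelingSchedule

/-! ### Gathering the neighborhood -/

section Gathering
variable {Input Output : Type u}

/-- What a node knows in the algorithm in which all nodes forward everything that they know. -/
structure GatherState (Input : Type u) : Type u where
  /-- the number of nodes -/
  card : ℕ
  /-- the own identifier -/
  ident : ℕ
  /-- the number of rounds so far -/
  round : ℕ
  /-- the own input -/
  input : Input
  /-- the known pairs of an identifier and the input of its node -/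
  inputs : Set (ℕ × Input)
  /-- the known edges, as pairs of identifiers -/
  edges : Set (ℕ × ℕ)

namespace GatherState

/-- The known part of the network, whose nodes are numbered from `0` instead of `1`. -/
def graph (s : GatherState Input) : SimpleGraph (Fin s.card) where
  Adj i j := i ≠ j ∧ (((i : ℕ) + 1, (j : ℕ) + 1) ∈ s.edges ∨ ((j : ℕ) + 1, (i : ℕ) + 1) ∈ s.edges)
  symm := ⟨fun _ _ h => ⟨h.1.symm, h.2.symm⟩⟩
  loopless := ⟨fun _ h => h.1 rfl⟩

/-- The known inputs; the own input stands in for the unknown ones. -/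
def inputOf (s : GatherState Input) (i : Fin s.card) : Input :=
  if h : ∃ x, ((i : ℕ) + 1, x) ∈ s.inputs then h.choose else s.input

end GatherState

/-- The algorithm that gathers information for `T` rounds, where `T` depends on the number of
nodes and the own input, and then evaluates `F` on the known part of the network. -/
def gatherAlgorithm (T : ℕ → Input → ℕ)
    (F : (n : ℕ) → Input → SimpleGraph (Fin n) → (Fin n → Input) → Fin n → Option Output) :
    LocalAlgorithm Input Output where
  State := GatherState Input
  Message := GatherState Input
  init n i x := ⟨n, i, 0, x, {(i, x)}, ∅⟩
  send s := s
  step s M := ⟨s.card, s.ident, s.round + 1, s.input,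
    s.inputs ∪ {p | ∃ m ∈ M, p ∈ m.2.inputs},
    s.edges ∪ {p | ∃ m ∈ M, p = (s.ident, m.1) ∨ p ∈ m.2.edges}⟩
  output s := if s.round = T s.card s.input then
      if h : s.ident - 1 < s.card then F s.card s.input s.graph s.inputOf ⟨s.ident - 1, h⟩ else none
    else none

variable {V : Type v} [Fintype V]

/-- The state of `x` after `t` rounds of gathering: it knows the inputs up to distance `t` and the
edges at the vertices of distance less than `t`. -/
def gatherState (G : SimpleGraph V) (ident : V → ℕ) (input : V → Input) (t : ℕ) (x : V) :
    GatherState Input :=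
  ⟨Fintype.card V, ident x, t, input x, {p | ∃ y, Within G t x y ∧ p = (ident y, input y)},
    {p | ∃ s < t, ∃ y z, Within G s x y ∧ G.Adj y z ∧ p = (ident y, ident z)}⟩

lemma state_gatherAlgorithm (T : ℕ → Input → ℕ)
    (F : (n : ℕ) → Input → SimpleGraph (Fin n) → (Fin n → Input) → Fin n → Option Output)
    (G : SimpleGraph V) (ident : V → ℕ) (input : V → Input) (t : ℕ) (x : V) :
    (gatherAlgorithm T F).state G ident input t x = gatherState G ident input t x := by
  induction t generalizing x with
  | zero =>
    change GatherState.mk _ _ _ _ _ _ = GatherState.mk _ _ _ _ _ _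
    congr 1
    · ext p
      simp only [within_zero, Set.mem_singleton_iff, Set.mem_ofPred_eq]
      exact ⟨fun h => ⟨x, rfl, h⟩, fun ⟨y, hy, h⟩ => by rw [h, hy]⟩
    · ext p
      simp
  | succ t ih =>
    rw [LocalAlgorithm.state]
    simp only [ih]
    change GatherState.mk _ _ _ _ _ _ = GatherState.mk _ _ _ _ _ _
    congr 1
    · ext p
      constructor
      · rintro (⟨y, hy, rfl⟩ | ⟨_, ⟨w, hw, rfl⟩, y, hy, rfl⟩)
        · exact ⟨y, hy.mono (Nat.le_succ t), rfl⟩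
        · exact ⟨y, within_succ.2 (Or.inr ⟨w, hw, hy⟩), rfl⟩
      · rintro ⟨y, hy, rfl⟩
        rcases within_succ.1 hy with rfl | ⟨w, hw, hy⟩
        · exact Or.inl ⟨x, Within.refl _ _, rfl⟩
        · exact Or.inr ⟨_, ⟨w, hw, rfl⟩, y, hy, rfl⟩
    · ext p
      constructor
      · rintro (⟨s, hs, y, z, hy, hyz, rfl⟩ | ⟨_, ⟨w, hw, rfl⟩, rfl | ⟨s, hs, y, z, hy, hyz, rfl⟩⟩)
        · exact ⟨s, by omega, y, z, hy, hyz, rfl⟩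
        · exact ⟨0, by omega, x, w, Within.refl _ _, hw, rfl⟩
        · exact ⟨s + 1, by omega, y, z, within_succ.2 (Or.inr ⟨w, hw, hy⟩), hyz, rfl⟩
      · rintro ⟨s, hs, y, z, hy, hyz, rfl⟩
        have hx : ∀ z, G.Adj x z → (ident x, ident z) ∈
            ({p | ∃ s < t, ∃ y z, Within G s x y ∧ G.Adj y z ∧ p = (ident y, ident z)} ∪
              {p | ∃ m ∈ {m | ∃ y, G.Adj x y ∧ m = (ident y, gatherState G ident input t y)},
                p = (ident x, m.1) ∨ p ∈ m.2.edges} : Set (ℕ × ℕ)) := fun z hz =>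
          Or.inr ⟨_, ⟨z, hz, rfl⟩, Or.inl rfl⟩
        cases s with
        | zero =>
          obtain rfl := within_zero.1 hy
          exact hx z hyz
        | succ s =>
          rcases within_succ.1 hy with rfl | ⟨w, hw, hy⟩
          · exact hx z hyz
          · exact Or.inr ⟨_, ⟨w, hw, rfl⟩, Or.inr ⟨s, by omega, y, z, hy, hyz, rfl⟩⟩

/-- If the function `F` is computable in `T` rounds, then gathering for `T` rounds computes it. -/
lemma gatherAlgorithm_chooses {T : ℕ → Input → ℕ}
    {F : (n : ℕ) → Input → SimpleGraph (Fin n) → (Fin n → Input) → Fin n → Option Output}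
    {G : SimpleGraph V} {ident : V → ℕ} {input : V → Input} (e : V ≃ Fin (Fintype.card V))
    (he : ∀ x, (e x : ℕ) + 1 = ident x) {x : V} {o : Output}
    (hF : ∀ (G' : SimpleGraph (Fin (Fintype.card V))) (f' : Fin (Fintype.card V) → Input)
      (Z : ℕ → Set (Fin (Fintype.card V))), Agreement (G.comap e.symm) G' Z →
      Set.EqOn (input ∘ e.symm) f' (Z 0) → Set.EqOn
        (F (Fintype.card V) (input x) (G.comap e.symm) (input ∘ e.symm))
        (F (Fintype.card V) (input x) G' f') (Z (T (Fintype.card V) (input x))))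
    (ho : F (Fintype.card V) (input x) (G.comap e.symm) (input ∘ e.symm) (e x) = some o) :
    (gatherAlgorithm T F).Chooses G ident input x (T (Fintype.card V) (input x)) o := by
  set t := T (Fintype.card V) (input x) with ht
  have hid : ∀ (y : V) (i : Fin (Fintype.card V)), (i : ℕ) + 1 = ident y ↔ e.symm i = y := by
    intro y i
    rw [← he y, Nat.add_right_cancel_iff, Fin.val_inj, e.symm_apply_eq]
  refine ⟨?_, fun s hs => ?_⟩
  · rw [state_gatherAlgorithm]
    have hlt : ident x - 1 < Fintype.card V := by
      rw [← he x, Nat.add_sub_cancel]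
      exact (e x).2
    have hx : (⟨ident x - 1, hlt⟩ : Fin (Fintype.card V)) = e x :=
      Fin.ext (Nat.sub_eq_of_eq_add (he x).symm)
    set S := gatherState G ident input t x with hS
    have hout : (gatherAlgorithm T F).output S =
        F (Fintype.card V) (input x) S.graph S.inputOf (e x) := by
      rw [← hx]
      exact (if_pos rfl).trans (dif_pos hlt)
    rw [hout, ← ho]
    refine (hF S.graph S.inputOf (fun s => {i | ∃ k, k + s ≤ t ∧ Within G k x (e.symm i)})
      ⟨fun s => ?_, fun {s i} hi j => ?_, fun {s i j} hi hij => ?_⟩ (fun i hi => ?_) ?_).symm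
    · rintro i ⟨k, hk, hw⟩
      exact ⟨k, by omega, hw⟩
    · obtain ⟨k, hk, hw⟩ := hi
      constructor
      · intro hij
        refine ⟨hij.ne, Or.inl ⟨k, by omega, e.symm i, e.symm j, hw, hij, ?_⟩⟩
        rw [Prod.mk.injEq]
        exact ⟨(hid _ _).2 rfl, (hid _ _).2 rfl⟩
      · rintro ⟨-, ⟨_, _, y, z, _, hyz, h⟩ | ⟨_, _, y, z, _, hyz, h⟩⟩ <;>
          rw [Prod.mk.injEq, hid, hid] at h
        · rw [← h.1, ← h.2] at hyz
          exact hyz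
        · rw [← h.1, ← h.2] at hyz
          exact hyz.symm
    · obtain ⟨k, hk, hw⟩ := hi
      exact ⟨k + 1, by omega, hw.trans (within_of_adj hij)⟩
    · obtain ⟨k, hk, hw⟩ := hi
      have hex : ∃ a, ((i : ℕ) + 1, a) ∈ S.inputs :=
        ⟨input (e.symm i), e.symm i, hw.mono hk, by rw [(hid (e.symm i) i).2 rfl]⟩
      obtain ⟨y, -, hy⟩ := hex.choose_spec
      rw [Prod.mk.injEq, hid] at hy
      have hval : S.inputOf i = hex.choose := dif_pos hex
      rw [hval, hy.2, ← hy.1]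
      rfl
    · exact ⟨0, by omega, by simpa using Within.refl 0 x⟩
  · rw [state_gatherAlgorithm]
    exact if_neg (by change s ≠ t; omega)

end Gathering

/-! ### Sparsity from arboricity -/

section Arboricity
variable {V : Type*}

/-- A forest on `W` has at most `|W| - 1` edges. -/
lemma sum_degIn_add_two_le_of_isAcyclic {F : SimpleGraph V} (hF : F.IsAcyclic) {W : Finset V}
    (hW : W.Nonempty) : ∑ x ∈ W, degIn F W x + 2 ≤ 2 * W.card := by
  have : Nonempty W := hW.to_subtype
  obtain ⟨T, hFT, -, hT⟩ := (SimpleGraph.connected_top (V := W)).exists_isTree_le_of_le_of_isAcyclic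
    (H := F.induce (W : Set V)) le_top (hF.induce (W : Set V))
  have h1 := hT.card_edgeFinset
  have h2 : ∑ x : W, T.degree x = 2 * T.edgeFinset.card := by
    convert! T.sum_degrees_eq_twice_card_edges
  have h3 : ∑ x ∈ W, degIn F W x ≤ ∑ x : W, T.degree x := by
    rw [← Finset.sum_coe_sort W]
    refine Finset.sum_le_sum fun x _ => ?_
    rw [← SimpleGraph.card_neighborFinset_eq_degree,
      ← Finset.card_map (Function.Embedding.subtype (· ∈ W))]
    refine Finset.card_le_card fun y hy => ?_
    obtain ⟨hyW, hxy⟩ := Finset.mem_filter.1 hy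
    refine Finset.mem_map.2 ⟨⟨y, hyW⟩, ?_, rfl⟩
    rw [SimpleGraph.mem_neighborFinset]
    exact hFT hxy
  rw [← Nat.card_eq_fintype_card, Nat.card_coe_set_eq, Set.ncard_coe_finset] at h1
  omega

/-- The union of `a` forests is sparse. -/
lemma degreeSparse_of_forests {G : SimpleGraph V} {a : ℕ} {F : Fin a → SimpleGraph V}
    (hF : ∀ i, (F i).IsAcyclic) (hG : ∀ x y, G.Adj x y → ∃ i, (F i).Adj x y) :
    DegreeSparse (2 * a) G := by
  intro W hW
  have h1 : ∑ x ∈ W, degIn G W x ≤ ∑ i, ∑ x ∈ W, degIn (F i) W x := by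
    rw [Finset.sum_comm]
    refine Finset.sum_le_sum fun x _ => ?_
    calc degIn G W x ≤ (Finset.univ.biUnion fun i => W.filter ((F i).Adj x)).card := by
          refine Finset.card_le_card fun y hy => ?_
          obtain ⟨hyW, hxy⟩ := Finset.mem_filter.1 hy
          obtain ⟨i, hi⟩ := hG x y hxy
          exact Finset.mem_biUnion.2 ⟨i, Finset.mem_univ _, Finset.mem_filter.2 ⟨hyW, hi⟩⟩
      _ ≤ _ := Finset.card_biUnion_le
  have h2 : ∑ i : Fin a, (∑ x ∈ W, degIn (F i) W x + 2) ≤ ∑ _i : Fin a, 2 * W.card :=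
    Finset.sum_le_sum fun i _ => sum_degIn_add_two_le_of_isAcyclic (hF i) hW
  simp only [Finset.sum_add_distrib, Finset.sum_const, Finset.card_univ, Fintype.card_fin,
    smul_eq_mul] at h2
  have h3 : 2 * a * W.card = a * (2 * W.card) := by ring
  omega

lemma exists_forests {G : SimpleGraph V} {a : ℕ} (ha : a ≠ 0) (h : arboricity G = a) :
    ∃ F : Fin a → SimpleGraph V, (∀ i, (F i).IsAcyclic) ∧
      ∀ x y, G.Adj x y → ∃ i, (F i).Adj x y := by
  have hne : {k : ℕ | ∃ F : Fin k → SimpleGraph V, IsForestPartition G k F}.Nonempty := by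
    by_contra hno
    rw [Set.not_nonempty_iff_eq_empty] at hno
    rw [arboricity, hno, Nat.sInf_empty] at h
    exact ha h.symm
  have hmem := Nat.sInf_mem hne
  change arboricity G ∈ _ at hmem
  rw [h] at hmem
  obtain ⟨F, hF⟩ := hmem
  refine ⟨F, hF.acyclic, fun x y hxy => ?_⟩
  have : s(x, y) ∈ ⋃ i, (F i).edgeSet := by
    rw [hF.cover]
    exact hxy
  simpa using this

lemma arboricity_eq_zero_of_subsingleton [Subsingleton V] (G : SimpleGraph V) :
    arboricity G = 0 := by
  refine Nat.le_zero.1 (Nat.sInf_le ⟨fun i => i.elim0, fun i => i.elim0, fun i => i.elim0, ?_⟩)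
  rw [Set.iUnion_of_empty, Subsingleton.elim G ⊥, SimpleGraph.edgeSet_bot]

end Arboricity

/-! ### The coloring algorithm -/

section Algorithm

/-- Exactly `k` elements of `s`, if there are as many. -/
def takeColors {Color : Type u} (k : ℕ) (s : Set Color) : Finset Color :=
  if h : ∃ t : Finset Color, (t : Set Color) ⊆ s ∧ t.card = k then h.choose else ∅

lemma takeColors_spec {Color : Type u} {k : ℕ} {s : Set Color} (h : (k : ℕ∞) ≤ s.encard) :
    (takeColors k s : Set Color) ⊆ s ∧ (takeColors k s).card = k := by
  have hex : ∃ t : Finset Color, (t : Set Color) ⊆ s ∧ t.card = k := by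
    obtain ⟨t, hts, ht⟩ := Set.exists_subset_encard_eq h
    have hfin : t.Finite := Set.finite_of_encard_eq_coe ht
    refine ⟨hfin.toFinset, by simpa using hts, ?_⟩
    rw [hfin.encard_eq_coe_toFinset_card] at ht
    exact_mod_cast ht
  rw [takeColors, dif_pos hex]
  exact hex.choose_spec

/-- The number of ranks of the schedule. -/
def rankBound (d l : ℕ) : ℕ := (l * (4 * (16 * d * l) + 1) + 1) * (d + 1)

/-- The number of rounds of the coloring algorithm for lists of size `d` and `l`-bit identifiers. -/
def coloringRounds (d l : ℕ) : ℕ :=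
  scheduleRounds d (16 * d * l) (14 * d ^ 2 * l) l + 2 * (16 * d * l) +
    14 * d ^ 2 * l * (rankBound d l + 1 + 2 * (2 * (16 * d * l)))

lemma coloringRounds_le {d l : ℕ} (hd : 1 ≤ d) (hl : 1 ≤ l) :
    coloringRounds d l ≤ 3500 * (d ^ 4 * l ^ 3) := by
  have hmono : ∀ i j, i ≤ 4 → j ≤ 3 → d ^ i * l ^ j ≤ d ^ 4 * l ^ 3 := fun i j hi hj =>
    Nat.mul_le_mul (Nat.pow_le_pow_right hd hi) (Nat.pow_le_pow_right hl hj)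
  unfold coloringRounds rankBound scheduleRounds
  have := hmono 0 0 (by omega) (by omega)
  have := hmono 0 1 (by omega) (by omega)
  have := hmono 1 1 (by omega) (by omega)
  have := hmono 1 2 (by omega) (by omega)
  have := hmono 2 1 (by omega) (by omega)
  have := hmono 3 1 (by omega) (by omega)
  have := hmono 2 2 (by omega) (by omega)
  have := hmono 3 2 (by omega) (by omega)
  have := hmono 3 3 (by omega) (by omega)
  have := hmono 4 1 (by omega) (by omega)
  have := hmono 4 2 (by omega) (by omega)
  nlinarith

/-- The coloring that the algorithm computes, as a function of the whole network. -/
def networkColoring (Color : Type u) (n a : ℕ) (G : SimpleGraph (Fin n))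
    (f : Fin n → ℕ × Set Color) : Fin n → Option Color :=
  let d := 2 * a
  let l := Nat.log 2 n + 1
  (peelingSchedule Color d (16 * d * l) (14 * d ^ 2 * l) l Fin.val G).coloring G
    (fun i => takeColors d (f i).2) (14 * d ^ 2 * l) (rankBound d l) (14 * d ^ 2 * l)

lemma Agreement.networkColoring {Color : Type u} {n a : ℕ} {G G' : SimpleGraph (Fin n)}
    {f f' : Fin n → ℕ × Set Color} {Z : ℕ → Set (Fin n)} (h : Agreement G G' Z)
    (hf : Set.EqOn f f' (Z 0)) :
    Set.EqOn (networkColoring Color n a G f) (networkColoring Color n a G' f')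
      (Z (coloringRounds (2 * a) (Nat.log 2 n + 1))) :=
  h.coloring (fun x hx => by rw [hf (h.antitone (Nat.zero_le _) hx)]) _ _ h.peelingSchedule
    clusterWithin_peelingSchedule clusterWithin_peelingSchedule _

lemma networkColoring_spec {Color : Type u} {n a : ℕ} (ha : 2 ≤ a) {G : SimpleGraph (Fin n)}
    (hsp : DegreeSparse (2 * a) G) {f : Fin n → ℕ × Set Color}
    (hf : ∀ i, ((2 * a : ℕ) : ℕ∞) ≤ (f i).2.encard) :
    (∀ i, ∃ col ∈ (f i).2, networkColoring Color n a G f i = some col) ∧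
      ∀ i j, G.Adj i j → networkColoring Color n a G f i ≠ networkColoring Color n a G f j := by
  rcases isEmpty_or_nonempty (Fin n) with hn | ⟨⟨i0⟩⟩
  · exact ⟨fun i => hn.elim i, fun i => hn.elim i⟩
  have hcol : Nonempty Color := by
    obtain ⟨h1, h2⟩ := takeColors_spec (hf i0)
    obtain ⟨col, -⟩ := Finset.card_pos.1 (show 0 < (takeColors (2 * a) (f i0).2).card by omega)
    exact ⟨col⟩
  have hlt : n < 2 ^ (Nat.log 2 n + 1) := Nat.lt_pow_succ_log_self (by norm_num) n
  obtain ⟨⟨h1, h2⟩, h3⟩ := (isValid_peelingSchedule (Color := Color) (G := G) (d := 2 * a)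
    (by omega) hsp (by rwa [Fintype.card_fin]) Fin.val_injective
    fun i => i.2.trans hlt).coloring_spec (L := fun i => takeColors (2 * a) (f i).2)
      fun i => (takeColors_spec (hf i)).2.ge
  refine ⟨fun i => ?_, fun i j hij => h2 i j hij (h3 i)⟩
  obtain ⟨col, hcol⟩ := Option.ne_none_iff_exists'.1 (h3 i)
  exact ⟨col, (takeColors_spec (hf i)).1 (h1 i col hcol), hcol⟩

lemma natLog_succ_le {n : ℕ} (hn : 2 ≤ n) : ((Nat.log 2 n + 1 : ℕ) : ℝ) ≤ 3 * Real.log n := by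
  have h0 : (0 : ℝ) < n := by exact_mod_cast (by omega : 0 < n)
  have h1 : ((2 : ℝ) ^ Nat.log 2 n) ≤ n := by
    exact_mod_cast Nat.pow_log_le_self 2 (by omega : n ≠ 0)
  have h2 := Real.log_le_log (by positivity) h1
  rw [Real.log_pow] at h2
  have h3 : Real.log 2 ≤ Real.log n := Real.log_le_log (by norm_num) (by exact_mod_cast hn)
  have h4 := Real.log_two_gt_d9
  push_cast
  have h5 : (0 : ℝ) ≤ Nat.log 2 n := Nat.cast_nonneg _
  nlinarith

lemma coloringRounds_le_log {n a : ℕ} (hn : 2 ≤ n) (ha : 1 ≤ a) :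
    (coloringRounds (2 * a) (Nat.log 2 n + 1) : ℝ) ≤ 1512000 * (a : ℝ) ^ 4 * Real.log n ^ 3 := by
  set l := Nat.log 2 n + 1 with hl
  have h1 : (coloringRounds (2 * a) l : ℝ) ≤ 3500 * ((2 * a : ℝ) ^ 4 * (l : ℝ) ^ 3) := by
    exact_mod_cast coloringRounds_le (d := 2 * a) (l := l) (by omega) (by omega)
  have h2 : (l : ℝ) ^ 3 ≤ (3 * Real.log n) ^ 3 :=
    pow_le_pow_left₀ (Nat.cast_nonneg _) (natLog_succ_le hn) 3
  calc (coloringRounds (2 * a) l : ℝ) ≤ 3500 * ((2 * a : ℝ) ^ 4 * (l : ℝ) ^ 3) := h1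
    _ ≤ 3500 * ((2 * a : ℝ) ^ 4 * (3 * Real.log n) ^ 3) := by gcongr
    _ = 1512000 * (a : ℝ) ^ 4 * Real.log n ^ 3 := by ring

/-- The identifiers number the vertices. -/
lemma IsIdentification.exists_equiv {V : Type v} [Fintype V] {ident : V → ℕ}
    (h : IsIdentification ident) :
    ∃ e : V ≃ Fin (Fintype.card V), ∀ x, (e x : ℕ) + 1 = ident x := by
  have hmem := fun x => Finset.mem_Icc.1 (h.mem x)
  let f : V → Fin (Fintype.card V) := fun x => ⟨ident x - 1, by
    have := hmem x
    omega⟩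
  have hf : ∀ x, (f x : ℕ) + 1 = ident x := fun x => Nat.sub_add_cancel (hmem x).1
  have hinj : Function.Injective f := fun x y hxy => h.injective (by rw [← hf, ← hf, hxy])
  exact ⟨Equiv.ofBijective f ((Fintype.bijective_iff_injective_and_card f).2
    ⟨hinj, (Fintype.card_fin _).symm⟩), hf⟩

end Algorithm

end

theorem corollary1p4 :
    ∃ C : ℝ, ∀ Color : Type u, ∃ A : LocalAlgorithm (ℕ × Set Color) Color,
      ∀ (V : Type v) [Fintype V] (G : SimpleGraph V) (a : ℕ), 2 ≤ a → arboricity G = a →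
      ∀ ident : V → ℕ, IsIdentification ident →
      ∀ L : V → Set Color, IsListAssignment (2 * a) L →
        ∃ c : G.Coloring Color, ∀ x : V, c x ∈ L x ∧
          ∃ t : ℕ, (t : ℝ) ≤ C * (a : ℝ) ^ 4 * Real.log (Fintype.card V) ^ 3 ∧
            A.Chooses G ident (fun y => (a, L y)) x t (c x) := by
  refine ⟨1512000, fun Color => ⟨gatherAlgorithm
    (fun n i => coloringRounds (2 * i.1) (Nat.log 2 n + 1))
    (fun n i => networkColoring Color n i.1), ?_⟩⟩
  intro V _ G a ha harb ident hident L hL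
  obtain ⟨e, he⟩ := hident.exists_equiv
  obtain ⟨F, hF, hGF⟩ := exists_forests (by omega) harb
  have hsp : DegreeSparse (2 * a) (G.comap e.symm) :=
    degreeSparse_of_forests (F := fun i => (F i).comap e.symm)
      (fun i => (hF i).of_comap e.symm.toEmbedding) fun x y hxy => hGF _ _ hxy
  obtain ⟨h1, h2⟩ := networkColoring_spec (Color := Color) ha hsp
    (f := (fun y => (a, L y)) ∘ e.symm) fun i => hL _
  choose c hcL hc using h1
  have hmem : ∀ x, c (e x) ∈ L x := fun x => by simpa using hcL (e x)
  refine ⟨SimpleGraph.Coloring.mk (fun x => c (e x)) fun {x y} hxy hne => ?_, fun x =>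
    ⟨hmem x, coloringRounds (2 * a) (Nat.log 2 (Fintype.card V) + 1), ?_, ?_⟩⟩
  · refine h2 (e x) (e y) (by simpa using hxy) ?_
    rw [hc, hc, hne]
  · -- for one vertex the logarithm would vanish, but then the arboricity is zero
    refine coloringRounds_le_log ?_ (by omega)
    by_contra hcard
    have : Subsingleton V := Fintype.card_le_one_iff_subsingleton.1 (by omega)
    rw [arboricity_eq_zero_of_subsingleton] at harb
    omega
  · exact gatherAlgorithm_chooses (F := fun n (i : ℕ × Set Color) => networkColoring Color n i.1)
      e he (fun G' f' Z h hf => h.networkColoring hf) (hc (e x))
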